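/- **Setting.** Let $\mathcal A$ be a $(\min,+)$ weighted automaton with finite state set $Q$, finite alphabet $\Sigma$, initial state $q_0$, and one weight in $\mathbb Z\cup\{\infty\}$ for each $(p,\sigma,q)$. The augmented automaton has state set $S=\{(q,p,T)\in Q\times Q\times 2^Q: q,p\in T\}$ (inner state, baseline component, reachable set), initial state $s_0=(q_0,q_0,\{q_0\})$, and the transitions $(q_1,\sigma,c,q_2)$ of $\mathcal A$ as its letters, the set of which is $\Gamma$: such a letter with $c\ne\infty$ leads from $(p_1,q_1,T)$ to $(p_2,q_2,\delta(T,\sigma))$ with weight $c'-c$, where $c'$ is the weight from $p_1$ to $p_2$ on $\sigma$; all other weights are $\infty$. A baseline state is a state $(p,p,T)$. Put $\mathfrak m=|S|\cdot|S|!$. For words $w$, $\mathrm{mwt}(s\xrightarrow{w}r)$ is the minimal weight of a run from $s$ to $r$ ($\infty$ if there is none), $\vec c_w(s)=\mathrm{mwt}(s_0\xrightarrow{w}s)$, and $\mathrm{maxeff}(w)$ is the sum over the letters of $w$ of the maximal absolute value of a finite weight on that letter. A run from $s_0$ is seamless if each of its prefixes has minimal weight among the runs from $s_0$ on the same prefix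 of the word with the same end state; it is a baseline run if it visits only baseline states. **Letters.** A pair $(S',w)$ is a stable cycle if $S'=\{(p,q,T):p\in T\}$ for some $T\subseteq Q$ and $q\in T$, if reading $w$ from $S'$ leads only into $S'$, and if for all $n\in\mathbb N$ the baseline state $(q,q,T)$ satisfies $\mathrm{mwt}((q,q,T)\xrightarrow{w^n}(q,q,T))=0$ and has a cycle on $w^n$ of minimal weight among all states of $S'$. Let $M$ be the set of states of $S'$ whose cycle on $w^{\mathfrak m}$ is finite and of minimal weight among all states of $S'$. A pair $(s,r)\in S'\times S'$ is grounded if $s\xrightarrow{w^{\mathfrak m}}g\xrightarrow{w^{\mathfrak m}}r$ for some $g\in M$. The cactus letter $\alpha_{S',w}$ has, for each grounded pair $(s,r)$, a transition from $s$ to $r$ whose weight is the minimal weight of such a run over $g\in M$, and no other transitions. $(S',w)$ is non-degenerate if there are $s,t\in S'$ and $k\ge1$ such that $t$ has a finite cycle on $w^{2\mathfrak m}$, $s\xrightarrow{w^{2\mathfrak mk}}t$, and $(s,t)$ is not grounded. For a grounded pair $s=(q_1,p,T)$, $r=(q_2,p,T)$ with $\alpha_{S',w}$-weight $c$, the rebase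 letter $\beta_{S',w,s\to r}$ has the transitions from $(q',q_1,T)$ to $(q'',q_2,T)$ of weight $d-c$, whenever $\alpha_{S',w}$ has weight $d<\infty$ from $(q',p,T)$ to $(q'',p,T)$. A jump letter has, for some $T$ and $p_1,p_2\in T$, exactly the transitions of weight $0$ from $(q',p_1,T)$ to $(q',p_2,T)$, $q'\in T$. Depth: $\mathrm{dep}=0$ on $\Gamma$, $\mathrm{dep}(\alpha_{S',w})=\mathrm{dep}(\beta_{S',w,s\to r})=1+\mathrm{dep}(w)$, and the depth of a word is the maximal depth of its letters ($0$ for the empty word). For $L:\mathbb N\to\mathbb N$ let $\Upsilon_L$ be the set of letters of depth at most $|S|-1$ that are built from $\Gamma$ using only cactus letters $\alpha_{S',w}$ with $(S',w)$ a non-degenerate stable cycle and $|w|\le L(\mathrm{dep}(\alpha_{S',w}))$; let $\Upsilon^1_L$ be $\Upsilon_L$ together with all rebase letters arising from its cactus letters; let $\Upsilon^{J}_L$ be $\Upsilon^1_L$ together with all jump letters; and let $\Upsilon^{1,1}_L$ be the set of all $\alpha_{S',w}$ with $(S',w)$ a stable cycle, $w\in(\Upsilon^1_L)^*$, $|w|\le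 L(\mathrm{dep}(w)+1)$. **Bounds.** Let $\mathrm{Ramsey}(k,n)$ be the least $R$ such that each $k$-colouring of the $2$-subsets of $\{1,\dots,R\}$ is constant on the $2$-subsets of some set with at least $n$ elements. For $H\ge 0$ and $\iota\in\{0,1\}$ define, for $d\ge0$, by recursion, with $\rho=\mathrm{Ramsey}(\mathrm{Typ}(d+1,i),3)$, $$\begin{aligned} &\mathrm{Len}(0,i)=1,\quad \mathrm{Len}(d,|S|+1)=1,\quad \mathrm{Cov}(d,|S|)=1,\quad \mathrm{MaxWt}(0)=\max_{\gamma\in\Gamma}\mathrm{maxeff}(\gamma),\\ &\mathrm{Len}(d+1,i)=32\mathfrak m^2\,\mathrm{Len}(d,1)\,\mathrm{Len}(d+1,i+1)\,(\rho+2)^{2\mathrm{Amp}(d+1,i)+1}\quad(i\le|S|),\\ &\mathrm{Cov}(d+1,i)=8\mathfrak m^2\big(\mathrm{MaxWt}(d)\,\mathrm{Len}(d,1)\,\mathrm{Len}(d+1,i+1)+\mathrm{Cov}(d+1,i+1)+H\big)\quad(i<|S|),\\ &\mathrm{MaxWt}(d+1)=2\mathfrak m\,\mathrm{MaxWt}(d)\,\mathrm{Len}(d+1,\iota),\\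 &\mathrm{Amp}(d+1,i)=32\mathfrak m^2\,(H+2\,\mathrm{MaxWt}(d))\,\big(\rho+\mathrm{Len}(d+1,i+1)+\mathrm{Len}(d,1)\big)\quad(i\le|S|),\\ &\mathrm{Typ}(d+1,i)=3^i\,(2\,\mathrm{Cov}(d+1,i)+2)^{2|S|i}\quad(i\le|S|). \end{aligned}$$ For $H=0$, $\iota=1$ these are the simple functions, and below $\mathrm{Len},\mathrm{Cov},\mathrm{Amp}$ always mean these; put $L_{\rm simp}(d)=\mathrm{Len}(d,1)$. Let $L_{\rm gen}(d)$ be the value at $(d,1)$ of the function $\mathrm{Len}$ obtained instead with $H=\mathrm{Amp}(|S|,0)$ and $\iota=0$. Put $\Upsilon=\Upsilon_{L_{\rm simp}}$, the simple effective cactus alphabet. **Potential.** A state $q$ with $\vec c(q)<\infty$ is dominant in a configuration $\vec c$ if some word $z\in(\Upsilon^{J}_{L_{\rm simp}})^*\cdot\Upsilon^{1,1}_{L_{\rm gen}}$ has a finite-weight run from $q$ but from no state $p$ with $\vec c(p)<\vec c(q)$. The potential $\phi(w)$ is the maximum of $\vec c_w(q)$ over the dominant states $q$ of $\vec c_w$.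 A decomposed word $w_1w_2w_3$ is potential increasing if there is a seamless baseline run on $w_1w_2w_3$ and $\phi(w_1)\le\phi(w_1w_2)$. **Simple separated repeating infix (simple SRI).** A decomposed word $uxyv\in\Upsilon^*$ with $x,y$ nonempty is a simple SRI if there is a seamless baseline run on $uxyv$ and: (1) $\vec c_u,\vec c_{ux},\vec c_{uxy}$ have the same support $B$; (2) $|x|\le\frac1{\mathfrak m}L_{\rm simp}(\mathrm{dep}(x)+1)$; (3) $B$ has a partition $V_1,\dots,V_\ell$ into nonempty sets such that $\vec c_\xi(s')-\vec c_\xi(s)>4|S|\,\mathfrak m\,\mathrm{maxeff}(xy)$ for all $1\le j<\ell$, $s\in V_j$, $s'\in V_{j+1}$, $\xi\in\{u,ux,uxy\}$, and for each $j$ there are integers $k_{j,x},k_{j,y}$ of the same sign (negative, zero or positive) with $\vec c_{ux}(s)=\vec c_u(s)+k_{j,x}$ and $\vec c_{uxy}(s)=\vec c_{ux}(s)+k_{j,y}$ for all $s\in V_j$; (4) $\phi(u)\le\phi(ux)\le\phi(uxy)$, and $\phi(u)=\phi(ux)$ if and only if $\phi(ux)=\phi(uxy)$. **Well-separated words.**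 For $d\ge0$ and $1\le i\le|S|$, a decomposed word $w_1w_2w_3\in\Upsilon^*$ with a set $I$ of seamless runs from $s_0$ on $w_1w_2$ is $(d,i)$-fit and well separated if it is potential increasing, $\mathrm{dep}(w_2)\le d$, $|w_2|\le\frac1{32\mathfrak m^2}\mathrm{Len}(d+1,i)$, $|I|=i$, and the weights of any two distinct runs of $I$ differ by at least $\frac12\mathrm{Cov}(d+1,i-1)$ after $w_1z$, for every prefix $z$ of $w_2$. **Theorem.** For every such automaton $\mathcal A$: (a) Let $d\ge 0$ and $1\le i\le|S|$, and let $w_1w_2w_3$ with $I$ be $(d,i)$-fit and well separated with $|w_2|=\frac1{32\mathfrak m^2}\mathrm{Len}(d+1,i)$. Then at least one of the following holds: - $w_1w_2w_3=uxyv$ where $uxyv$ is a simple SRI, $\mathrm{dep}(x)=d$, and $xy$ is an infix of $w_2$ at the corresponding position (that is, $w_1$ is a prefix of $u$ and $w_3$ is a suffix of $v$); - $d\ge1$, and $w_1w_2w_3=w_1'w_2'w_3'$ where $w_1'w_2'w_3'$, with some $I'$, is $(d-1,1)$-fit and well separated, $w_2'$ is an infix of $w_2$ at the corresponding position, and $|w_2'|=\frac1{32\mathfrak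 m^2}\mathrm{Len}(d,1)$. (b) Let $w_1w_2w_3\in\Upsilon^*$ be potential increasing with $|w_2|=\frac1{32\mathfrak m^2}\mathrm{Len}(|S|,1)$. Then $w_1w_2w_3=uxyv$ where $uxyv$ is a simple SRI and $xy$ is an infix of $w_2$ at the corresponding position. -/

import Mathlib

universe u v

/-! ### Weighted automata and the states of the baseline-augmented construction -/

/-- A `(min,+)` weighted automaton: every `p, a, q` carries exactly one weight in `ℤ ∪ {∞}`,
weight `⊤` meaning that there is no transition. -/
structure WFA (Q : Type u) (α : Type v) where
  wt : Q → α → Q → WithTop ℤ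
  init : Q

/-- The states `(q, p, T)` with `q, p ∈ T`: inner state, baseline component, reachable subset. -/
abbrev AugState (Q : Type u) : Type u :=
  {x : Q × Q × Finset Q // x.1 ∈ x.2.2 ∧ x.2.1 ∈ x.2.2}

namespace AugState

variable {Q : Type u}

def inner (s : AugState Q) : Q := s.1.1

def base (s : AugState Q) : Q := s.1.2.1

def reach (s : AugState Q) : Finset Q := s.1.2.2

/-- Baseline states are those of the form `(p, p, T)`. -/
def IsBaseline (s : AugState Q) : Prop := s.inner = s.base

/-- The stabilisation constant `𝔪 = |S| · |S|!`. -/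
def stabConst (Q : Type u) [Fintype Q] [DecidableEq Q] : ℕ :=
  Fintype.card (AugState Q) * (Fintype.card (AugState Q)).factorial

end AugState

/-! ### Runs

The transitions on a letter form a matrix `s, r ↦ weight` (`⊤` when there is no transition);
in this part a word is the list of the matrices of its letters. -/

/-- The transitions of a single letter. -/
abbrev LetterTrans (Q : Type u) : Type u := AugState Q → AugState Q → WithTop ℤ

namespace LetterTrans

variable {Q : Type u}

/-- The weight of the run on `w` that starts in `s` and visits the states `π` one after the other,
one state after each letter. It is `⊤` iff some transition is missing (or the lengths differ),
that is, iff this is not a run. -/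
def runWt : AugState Q → List (LetterTrans Q) → List (AugState Q) → WithTop ℤ
  | _, [], [] => 0
  | s, M :: w, r :: π => M s r + runWt r w π
  | _, _, _ => ⊤

/-- The last state of the run from `s` that visits the states `π`. -/
def endState : AugState Q → List (AugState Q) → AugState Q
  | s, [] => s
  | _, r :: π => endState r π

variable [Fintype Q] [DecidableEq Q]

/-- `mwt w s r`: the minimal weight of a run on `w` from `s` to `r`. -/
def mwt : List (LetterTrans Q) → AugState Q → AugState Q → WithTop ℤ
  | [], s, r => if s = r then 0 else ⊤
  | M :: w, s, r => Finset.univ.inf fun t => M s t + mwt w t r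

/-- `mwt` is a lower bound for the weights of runs. -/
theorem mwt_le_runWt (w : List (LetterTrans Q)) (s : AugState Q) (π : List (AugState Q)) :
    mwt w s (endState s π) ≤ runWt s w π := by
  induction w generalizing s π with
  | nil => cases π <;> simp [mwt, runWt, endState]
  | cons M w ih =>
    cases π with
    | nil => simp [runWt]
    | cons r π =>
      exact (Finset.inf_le (Finset.mem_univ r)).trans (add_le_add le_rfl (ih r π))

/-- `mwt` is attained by a run as soon as it is finite. -/
theorem exists_runWt_eq_mwt (w : List (LetterTrans Q)) (s r : AugState Q) (h : mwt w s r ≠ ⊤) :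
    ∃ π, endState s π = r ∧ runWt s w π = mwt w s r := by
  induction w generalizing s with
  | nil =>
    refine ⟨[], ?_, ?_⟩
    · by_contra hne
      exact h (if_neg hne)
    · have hsr : s = r := by
        by_contra hne
        exact h (if_neg hne)
      simp [mwt, runWt, hsr]
  | cons M w ih =>
    obtain ⟨t, -, ht⟩ := Finset.exists_mem_eq_inf (Finset.univ : Finset (AugState Q)) ⟨s, by simp⟩
      (fun t => M s t + mwt w t r)
    have h0 : mwt (M :: w) s r = M s t + mwt w t r := ht
    have h1 : mwt w t r ≠ ⊤ := by
      intro h2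
      rw [h0, h2] at h
      simp at h
    obtain ⟨π, hπ, hw⟩ := ih t h1
    refine ⟨t :: π, hπ, ?_⟩
    rw [h0, ← hw]
    rfl

/-- The run from `s` visiting `π` is seamless: it is a run, and each of its prefixes has minimal
weight among all runs from `s` on the same prefix of `w` with the same end state. -/
def IsSeamless (s : AugState Q) (w : List (LetterTrans Q)) (π : List (AugState Q)) : Prop :=
  π.length = w.length ∧ runWt s w π ≠ ⊤ ∧
    ∀ j ≤ w.length,
      runWt s (w.take j) (π.take j) = mwt (w.take j) s (endState s (π.take j))

/-- The word `w ^ n`. -/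
def pow (w : List (LetterTrans Q)) (n : ℕ) : List (LetterTrans Q) := (List.replicate n w).flatten

/-- The maximal absolute value of a finite weight occurring on a letter. -/
def wmax (M : LetterTrans Q) : ℕ :=
  Finset.univ.sup fun p : AugState Q × AugState Q => ((M p.1 p.2).untopD 0).natAbs

/-- The maximal effect of a word. -/
def maxeff (w : List (LetterTrans Q)) : ℕ := (w.map wmax).sum

/-! ### Stable cycles and stabilisation -/

/-- Reflexive states of `(S', w)`. -/
def IsRefState (S' : Finset (AugState Q)) (w : List (LetterTrans Q)) (s : AugState Q) : Prop :=
  s ∈ S' ∧ mwt w s s ≠ ⊤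

/-- Minimal reflexive states of `(S', w)`. -/
def IsMinState (S' : Finset (AugState Q)) (w : List (LetterTrans Q)) (s : AugState Q) : Prop :=
  IsRefState S' w s ∧ ∀ r, IsRefState S' w r → mwt w s s ≤ mwt w r r

/-- `(S', w)` is a stable cycle: `S'` consists of all states `(p, q, T)`, `p ∈ T`, for some `T` and
`q ∈ T`; reading `w` leads from `S'` into `S'`; and for every `n`, the baseline state `(q, q, T)`
is minimal reflexive for `w ^ n`, with a cycle of weight `0`. -/
def IsStableCycle (S' : Finset (AugState Q)) (w : List (LetterTrans Q)) : Prop :=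
  ∃ b : AugState Q, b.IsBaseline ∧
    (∀ s, s ∈ S' ↔ s.base = b.base ∧ s.reach = b.reach) ∧
    (∀ s ∈ S', ∀ r, mwt w s r ≠ ⊤ → r ∈ S') ∧
    ∀ n : ℕ, IsMinState S' (pow w n) b ∧ mwt (pow w n) b b = 0

/-- Grounded pairs of `(S', w)`. -/
def IsGrounded (S' : Finset (AugState Q)) (w : List (LetterTrans Q)) (s r : AugState Q) : Prop :=
  s ∈ S' ∧ r ∈ S' ∧ ∃ g, IsMinState S' (pow w (AugState.stabConst Q)) g ∧
    mwt (pow w (AugState.stabConst Q)) s g ≠ ⊤ ∧ mwt (pow w (AugState.stabConst Q)) g r ≠ ⊤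

/-- `(S', w)` is non-degenerate: some `s ∈ S'` reaches, by some `w ^ (2𝔪k)` with `k ≥ 1`, a state
`t` that is reflexive for `w ^ (2𝔪)` although `(s, t)` is not grounded. -/
def IsNondegenerate (S' : Finset (AugState Q)) (w : List (LetterTrans Q)) : Prop :=
  ∃ s ∈ S', ∃ t, IsRefState S' (pow w (2 * AugState.stabConst Q)) t ∧
    (∃ k : ℕ, 1 ≤ k ∧ mwt (pow w (2 * AugState.stabConst Q * k)) s t ≠ ⊤) ∧
    ¬ IsGrounded S' w s t

open Classical in
/-- The transitions of the cactus letter `α_{S', w}`: a grounded pair `(s, r)` has the minimal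
weight of a run `s → g → r` on `w ^ 𝔪 · w ^ 𝔪` through a minimal reflexive state `g` of
`(S', w ^ 𝔪)`. -/
noncomputable def cactus (S' : Finset (AugState Q)) (w : List (LetterTrans Q)) : LetterTrans Q :=
  fun s r =>
    if IsGrounded S' w s r then
      (Finset.univ.filter fun g => IsMinState S' (pow w (AugState.stabConst Q)) g).inf
        fun g => mwt (pow w (AugState.stabConst Q)) s g + mwt (pow w (AugState.stabConst Q)) g r
    else ⊤

open Classical in
/-- The transitions of the rebase letter `β_{S', w, s → r}` with `s = (q₁, p, T)`,
`r = (q₂, p, T)`: if `α_{S', w}` has weight `c` from `s` to `r`, and weight `d` from `(q', p, T)` to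
`(q'', p, T)`, then there is a transition of weight `d - c` from `(q', q₁, T)` to `(q'', q₂, T)`. -/
noncomputable def rebase (S' : Finset (AugState Q)) (w : List (LetterTrans Q)) (s r : AugState Q) :
    LetterTrans Q :=
  fun x y =>
    if h : x.base = s.inner ∧ x.inner ∈ s.reach ∧ x.reach = s.reach ∧
        y.base = r.inner ∧ y.inner ∈ r.reach ∧ y.reach = r.reach then
      match cactus S' w s r with
      | ⊤ => ⊤
      | (c : ℤ) =>
        cactus S' w ⟨(x.inner, s.base, s.reach), h.2.1, s.2.2⟩
          ⟨(y.inner, r.base, r.reach), h.2.2.2.2.1, r.2.2⟩ + ((-c : ℤ) : WithTop ℤ)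
    else ⊤

/-- The transitions of the jump letter `jump_{s → r}` with `s = (q, p₁, T)`, `r = (q, p₂, T)`:
weight `0` from every `(q', p₁, T)` to `(q', p₂, T)`. -/
def jump (s r : AugState Q) : LetterTrans Q :=
  fun x y =>
    if x.base = s.base ∧ x.reach = s.reach ∧ y.base = r.base ∧ y.reach = r.reach ∧
        x.inner = y.inner then 0 else ⊤

end LetterTrans

/-! ### Letters -/

/-- Expressions for letters: the letters of the augmented automaton (transitions `(p, a, c, q)` of
the given automaton, the weight `c` being determined by `p, a, q`), and cactus, rebase and jump
letters. Which of them belong to an alphabet is decided below. -/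
inductive CactusLetter (Q : Type u) (α : Type v) : Type (max u v) where
  | base (p : Q) (a : α) (q : Q)
  | cactus (S' : Finset (AugState Q)) (w : List (CactusLetter Q α))
  | rebase (S' : Finset (AugState Q)) (w : List (CactusLetter Q α)) (s r : AugState Q)
  | jump (s r : AugState Q)

namespace CactusLetter

variable {Q : Type u} {α : Type v}

mutual

/-- The depth of a letter. -/
def depth : CactusLetter Q α → ℕ
  | base _ _ _ => 0
  | cactus _ w => 1 + wordDepth w
  | rebase _ w _ _ => 1 + wordDepth w
  | jump _ _ => 0

/-- The depth of a word, the maximal depth of its letters. -/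
def wordDepth : List (CactusLetter Q α) → ℕ
  | [] => 0
  | a :: w => max (depth a) (wordDepth w)

end

end CactusLetter

/-! ### The recursive bounds

The simple and the general bound functions follow the same recursion; they differ in the additive
constant `H` (which is `0` for the simple ones) and in the index `ι` with which `maxW` calls `len`. -/

/-- `Ramsey(k, n)`: the least `R` such that every `k`-colouring of the two-element subsets of an
`R`-element set is constant on the two-element subsets of some set with at least `n` elements. -/
noncomputable def ramseyNumber (k n : ℕ) : ℕ :=
  sInf {R : ℕ | ∀ c : {e : Finset (Fin R) // e.card = 2} → Fin k,
    ∃ X : Finset (Fin R), n ≤ X.card ∧ ∀ e e', e.1 ⊆ X → e'.1 ⊆ X → c e = c e'}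

/-- Parameters of the recursion: `N = |S|`, the stabilisation constant `m = 𝔪`, the maximal weight
`W₀` in the augmented automaton, and the two parameters `H`, `ι` explained above. -/
structure BoundParams where
  N : ℕ
  m : ℕ
  W₀ : ℕ
  H : ℕ
  ι : ℕ

namespace BoundParams

mutual

/-- `Len(d, i)`, with base values `Len(0, i) = 1` and `Len(d, |S| + 1) = 1`. -/
noncomputable def len (P : BoundParams) (d i : ℕ) : ℕ :=
  match d with
  | 0 => 1
  | d + 1 =>
    if i ≤ P.N then
      32 * P.m ^ 2 * len P d 1 * len P (d + 1) (i + 1) *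
        (ramseyNumber (typ P (d + 1) i) 3 + 2) ^ (2 * amp P (d + 1) i + 1)
    else 1
termination_by (d, P.N + 1 - i, 3)
decreasing_by all_goals simp [Prod.lex_def]; try omega

/-- `Amp(d, i)`, used for `d ≥ 1` and `i ≤ |S|` only. -/
noncomputable def amp (P : BoundParams) (d i : ℕ) : ℕ :=
  match d with
  | 0 => 0
  | d + 1 =>
    if i ≤ P.N then
      32 * P.m ^ 2 * (P.H + 2 * maxW P d) *
        (ramseyNumber (typ P (d + 1) i) 3 + len P (d + 1) (i + 1) + len P d 1)
    else 0
termination_by (d, P.N + 1 - i, 2)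
decreasing_by all_goals simp [Prod.lex_def]; try omega

/-- `Typ(d, i)`, used for `d ≥ 1` only. -/
noncomputable def typ (P : BoundParams) (d i : ℕ) : ℕ :=
  3 ^ i * (2 * cov P d i + 2) ^ (2 * P.N * i)
termination_by (d, P.N + 1 - i, 1)
decreasing_by all_goals simp [Prod.lex_def]; try omega

/-- `Cov(d, i)`, with base value `Cov(d, |S|) = 1`. -/
noncomputable def cov (P : BoundParams) (d i : ℕ) : ℕ :=
  match d with
  | 0 => 1
  | d + 1 =>
    if i < P.N then
      8 * P.m ^ 2 * (maxW P d * len P d 1 * len P (d + 1) (i + 1) + cov P (d + 1) (i + 1) + P.H)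
    else 1
termination_by (d, P.N + 1 - i, 0)
decreasing_by all_goals simp [Prod.lex_def]; try omega

/-- `MaxWt(d)`. -/
noncomputable def maxW (P : BoundParams) (d : ℕ) : ℕ :=
  match d with
  | 0 => P.W₀
  | d + 1 => 2 * P.m * maxW P d * len P (d + 1) P.ι
termination_by (d, P.N + 2, 0)
decreasing_by all_goals simp [Prod.lex_def]; try omega

end

end BoundParams

namespace WFA

open LetterTrans CactusLetter

variable {Q : Type u} {α : Type v} [Fintype Q] [DecidableEq Q]

/-! ### The augmented automaton and its letters -/

/-- The initial state `(q₀, q₀, {q₀})`. -/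
def augInit (A : WFA Q α) : AugState Q :=
  ⟨(A.init, A.init, {A.init}), by simp⟩

/-- The states reachable from `T` by one transition on `a`. -/
def step (A : WFA Q α) (T : Finset Q) (a : α) : Finset Q :=
  Finset.univ.filter fun q => ∃ p ∈ T, A.wt p a q ≠ ⊤

/-- The transitions of the augmented automaton on the letter `(q₁, a, c, q₂)`: if `c ≠ ∞`, there is
a transition of weight `c' - c` from `(p₁, q₁, T₁)` to `(p₂, q₂, δ(T₁, a))`, where `c'` is the weight
from `p₁` to `p₂` on `a`. -/
def baseTrans (A : WFA Q α) (q₁ : Q) (a : α) (q₂ : Q) : LetterTrans Q :=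
  fun s r =>
    match A.wt q₁ a q₂ with
    | ⊤ => ⊤
    | (c : ℤ) =>
      if s.base = q₁ ∧ r.base = q₂ ∧ r.reach = A.step s.reach a then
        A.wt s.inner a r.inner + ((-c : ℤ) : WithTop ℤ)
      else ⊤

mutual

/-- The transitions of a letter. -/
noncomputable def letterTrans (A : WFA Q α) : CactusLetter Q α → LetterTrans Q
  | .base p a q => A.baseTrans p a q
  | .cactus S' w => LetterTrans.cactus S' (wordTrans A w)
  | .rebase S' w s r => LetterTrans.rebase S' (wordTrans A w) s r
  | .jump s r => LetterTrans.jump s r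

/-- The transitions of the letters of a word. -/
noncomputable def wordTrans (A : WFA Q α) : List (CactusLetter Q α) → List (LetterTrans Q)
  | [] => []
  | a :: w => letterTrans A a :: wordTrans A w

end

/-- The configuration reached by reading `w` from the initial state. -/
noncomputable def conf (A : WFA Q α) (w : List (CactusLetter Q α)) : AugState Q → WithTop ℤ :=
  fun s => mwt (A.wordTrans w) A.augInit s

/-- The maximal effect of a word over the extended alphabet. -/
noncomputable def wordEff (A : WFA Q α) (w : List (CactusLetter Q α)) : ℕ := maxeff (A.wordTrans w)

/-- `A.IsRunSeamless w π`: the states `π` form a seamless run on `w` from the initial state. -/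
def IsRunSeamless (A : WFA Q α) (w : List (CactusLetter Q α)) (π : List (AugState Q)) : Prop :=
  IsSeamless A.augInit (A.wordTrans w) π

/-- There is a seamless baseline run on `w` (the initial state is a baseline state). -/
def HasSeamlessBaseline (A : WFA Q α) (w : List (CactusLetter Q α)) : Prop :=
  ∃ π, A.IsRunSeamless w π ∧ ∀ s ∈ π, s.IsBaseline

/-! ### Effective alphabets -/

/-- Cactus letters of any depth over the augmented automaton (without rebase and jump letters),
all of whose nested cactus letters `α_{S', w}` come from non-degenerate stable cycles and satisfy
`|w| ≤ L(dep(α_{S', w}))`. -/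
inductive IsBounded (A : WFA Q α) (L : ℕ → ℕ) : CactusLetter Q α → Prop
  | base (p : Q) (a : α) (q : Q) : IsBounded A L (.base p a q)
  | cactus (S' : Finset (AugState Q)) (w : List (CactusLetter Q α))
      (hw : ∀ a ∈ w, IsBounded A L a)
      (hlen : w.length ≤ L (depth (.cactus S' w)))
      (hstable : IsStableCycle S' (A.wordTrans w))
      (hnondeg : IsNondegenerate S' (A.wordTrans w)) :
      IsBounded A L (.cactus S' w)

/-- The `L`-bounded cactus letters, of depth at most `|S| - 1`. -/
def cacAlph (A : WFA Q α) (L : ℕ → ℕ) : Set (CactusLetter Q α) :=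
  {a | A.IsBounded L a ∧ a.depth < Fintype.card (AugState Q)}

/-- `L`-bounded cactus letters together with the rebase letters that they induce. -/
def cacRebAlph (A : WFA Q α) (L : ℕ → ℕ) : Set (CactusLetter Q α) :=
  A.cacAlph L ∪ {a | ∃ S' w s r, CactusLetter.cactus S' w ∈ A.cacAlph L ∧
    IsGrounded S' (A.wordTrans w) s r ∧ a = .rebase S' w s r}

/-- Cactus letters `α_{S', w}` over words `w` of `cacRebAlph` with `|w| ≤ L(dep(w) + 1)`. -/
def cacRebCacAlph (A : WFA Q α) (L : ℕ → ℕ) : Set (CactusLetter Q α) :=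
  {a | ∃ S' w, (∀ b ∈ w, b ∈ A.cacRebAlph L) ∧ w.length ≤ L (wordDepth w + 1) ∧
    IsStableCycle S' (A.wordTrans w) ∧ a = .cactus S' w}

/-- `L`-bounded cactus letters, rebase letters and jump letters. -/
def cacRebJumpAlph (A : WFA Q α) (L : ℕ → ℕ) : Set (CactusLetter Q α) :=
  A.cacRebAlph L ∪ {a | ∃ s r, s.inner = r.inner ∧ s.reach = r.reach ∧ a = .jump s r}

variable [Fintype α]

/-- The maximal weight of a transition of the augmented automaton. -/
def maxBaseWt (A : WFA Q α) : ℕ :=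
  Finset.univ.sup fun t : Q × α × Q => wmax (A.baseTrans t.1 t.2.1 t.2.2)

def simpParams (A : WFA Q α) : BoundParams where
  N := Fintype.card (AugState Q)
  m := AugState.stabConst Q
  W₀ := A.maxBaseWt
  H := 0
  ι := 1

noncomputable def genParams (A : WFA Q α) : BoundParams where
  N := Fintype.card (AugState Q)
  m := AugState.stabConst Q
  W₀ := A.maxBaseWt
  H := A.simpParams.amp (Fintype.card (AugState Q)) 0
  ι := 0

/-- `Len(d, i)`. -/
noncomputable def simpLen (A : WFA Q α) (d i : ℕ) : ℕ := A.simpParams.len d i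

/-- `Cov(d, i)`. -/
noncomputable def simpCov (A : WFA Q α) (d i : ℕ) : ℕ := A.simpParams.cov d i

/-- The simple length bound. -/
noncomputable def Lsimp (A : WFA Q α) (d : ℕ) : ℕ := A.simpLen d 1

/-- The general length bound. -/
noncomputable def Lgen (A : WFA Q α) (d : ℕ) : ℕ := A.genParams.len d 1

/-- The simple effective cactus alphabet. -/
noncomputable def simpAlph (A : WFA Q α) : Set (CactusLetter Q α) := A.cacAlph A.Lsimp

/-! ### Dominance and potential -/

/-- `q` is dominant in the configuration `c`: it is in the support of `c`, and some suffix `z a`,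
with `z` over the simple alphabet with rebase and jump letters and `a` a cactus letter over the
general alphabet with rebase letters, can be read from `q` but from no state lower than `q`. -/
def IsDominant (A : WFA Q α) (c : AugState Q → WithTop ℤ) (q : AugState Q) : Prop :=
  c q ≠ ⊤ ∧ ∃ z a, (∀ b ∈ z, b ∈ A.cacRebJumpAlph A.Lsimp) ∧ a ∈ A.cacRebCacAlph A.Lgen ∧
    (∃ r, mwt (A.wordTrans (z ++ [a])) q r ≠ ⊤) ∧
    ∀ p, c p < c q → ∀ r, mwt (A.wordTrans (z ++ [a])) p r = ⊤

/-- The maximal weight of a dominant state (a maximum over a finite set, which is nonempty as soon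
as `c` has nonempty support). -/
noncomputable def domVal (A : WFA Q α) (c : AugState Q → WithTop ℤ) : ℤ :=
  sSup {k : ℤ | ∃ q, A.IsDominant c q ∧ c q = k}

/-- The potential of a word. -/
noncomputable def potential (A : WFA Q α) (w : List (CactusLetter Q α)) : ℤ := A.domVal (A.conf w)

/-! ### Potential-increasing and well-separated words -/

/-- The decomposed word `w₁w₂w₃` is potential increasing. -/
def IsPotentialIncreasing (A : WFA Q α) (w₁ w₂ w₃ : List (CactusLetter Q α)) : Prop :=
  A.HasSeamlessBaseline (w₁ ++ w₂ ++ w₃) ∧ A.potential w₁ ≤ A.potential (w₁ ++ w₂)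

/-- `I` is a set of seamless runs on `w₁w₂` whose weights pairwise differ by at least `G / 2` after
`w₁` followed by any prefix of `w₂`. -/
def IsHalfIndependent (A : WFA Q α) (w₁ w₂ : List (CactusLetter Q α)) (G : ℕ)
    (I : Finset (List (AugState Q))) : Prop :=
  (∀ π ∈ I, A.IsRunSeamless (w₁ ++ w₂) π) ∧
  ∀ π ∈ I, ∀ π' ∈ I, π ≠ π' → ∀ x y, w₂ = x ++ y → ∀ k k' : ℤ,
    runWt A.augInit (A.wordTrans (w₁ ++ x)) (π.take (w₁ ++ x).length) = k →
    runWt A.augInit (A.wordTrans (w₁ ++ x)) (π'.take (w₁ ++ x).length) = k' →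
    (G : ℤ) ≤ 2 * |k - k'|

/-- `w₁w₂w₃`, with the set `I` of runs, is `(d, i)`-fit and well separated. -/
structure IsWellSeparated (A : WFA Q α) (d i : ℕ) (w₁ w₂ w₃ : List (CactusLetter Q α))
    (I : Finset (List (AugState Q))) : Prop where
  mem_alph : ∀ a ∈ w₁ ++ w₂ ++ w₃, a ∈ A.simpAlph
  increasing : A.IsPotentialIncreasing w₁ w₂ w₃
  depth_le : wordDepth w₂ ≤ d
  length_le : 32 * AugState.stabConst Q ^ 2 * w₂.length ≤ A.simpLen (d + 1) i
  card_eq : I.card = i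
  independent : A.IsHalfIndependent w₁ w₂ (A.simpCov (d + 1) (i - 1)) I

/-! ### Simple separated repeating infixes -/

/-- `uxyv` is a simple separated repeating infix. -/
structure IsSSRI (A : WFA Q α) (u x y v : List (CactusLetter Q α)) : Prop where
  mem_alph : ∀ a ∈ u ++ x ++ y ++ v, a ∈ A.simpAlph
  x_ne : x ≠ []
  y_ne : y ≠ []
  supp_x : ∀ s, A.conf (u ++ x) s = ⊤ ↔ A.conf u s = ⊤
  supp_y : ∀ s, A.conf (u ++ x ++ y) s = ⊤ ↔ A.conf u s = ⊤
  length_le : AugState.stabConst Q * x.length ≤ A.Lsimp (wordDepth x + 1)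
  partition : ∃ (l : ℕ) (V : Fin l → Finset (AugState Q)),
    (∀ j, (V j).Nonempty) ∧
    (∀ j j', j ≠ j' → Disjoint (V j) (V j')) ∧
    (∀ s, (∃ j, s ∈ V j) ↔ A.conf u s ≠ ⊤) ∧
    (∀ j j' : Fin l, (j : ℕ) + 1 = j' → ∀ s ∈ V j, ∀ s' ∈ V j',
      ∀ ξ ∈ [u, u ++ x, u ++ x ++ y],
        A.conf ξ s + ((4 * Fintype.card (AugState Q) * AugState.stabConst Q *
          A.wordEff (x ++ y) : ℕ) : WithTop ℤ) < A.conf ξ s') ∧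
    ∀ j, ∃ kx ky : ℤ, kx.sign = ky.sign ∧ ∀ s ∈ V j,
      A.conf (u ++ x) s = A.conf u s + (kx : WithTop ℤ) ∧
      A.conf (u ++ x ++ y) s = A.conf (u ++ x) s + (ky : WithTop ℤ)
  baseline : A.HasSeamlessBaseline (u ++ x ++ y ++ v)
  potential_x : A.potential u ≤ A.potential (u ++ x)
  potential_y : A.potential (u ++ x) ≤ A.potential (u ++ x ++ y)
  potential_iff : A.potential u = A.potential (u ++ x) ↔
    A.potential (u ++ x) = A.potential (u ++ x ++ y)

end WFA

/-!
Both parts of the theorem rest on one argument, carried out for `(d, i)`-fit and well separated words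
by downward induction on the number `i` of runs. Read `w₂` letter by letter, and let `φ t` be the
potential after `t` letters. Three facts are needed.

* The potential grows by at most the effect of what is read (`WFA.potential_append_le`): a suffix
  that makes a state dominant after `x` gives, prefixed with `x`, a state that is dominant before `x`.
  A drop of the potential is not bounded. The effect is controlled by `WFA.wordEff_le_maxW`.
* If, after a window of length `Len(d + 1, i + 1) / (32𝔪²)` along which `φ` does not drop, some state
  is further than `Cov(d + 1, i)` from all runs of `I`, then a seamless run to that state stays away
  from `I` along the window, which is therefore `(d, i + 1)`-fit and well separated
  (`WFA.IsWellSeparated.exists_succ`), and the induction hypothesis applies. If `i = |S|`, the runs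
  occupy all states and no state is far away.
* If, along a window of length `Len(d, 1) / (32𝔪²)`, `φ` does not drop and no letter of depth `d` is
  read, then the window is the word required by the second alternative.

So one may assume that after every window without drop all states are near the runs, and that a
letter of depth `d` occurs in it. The numerical part of the proof, `exists_record_times`, finds `ρ`
times at which `φ` is at least as high as at the preceding times, and on which `φ` is either constant,
the times being far apart, or increases by more than `MaxWt(d)` at each step. If `φ` rises somewhere
by more than `Amp(d + 1, i)`, one takes the first times at which it reaches equidistant levels.
Otherwise it takes at most `2 Amp(d + 1, i) + 1` values, and removing the highest value as long as it
is rare leaves an interval in which the highest value is frequent. Between two of the times a letter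
of depth `d` is read: in the increasing case, letters of smaller depth would need more than
`Len(d, 1)` steps for the rise.

Ramsey's theorem now yields three of the times such that all runs move in the same directions, and
all states have the same distances to the runs (`exists_similar_positions`). The sets of states
near the individual runs are the partition in the definition of a separated repeating infix
(`exists_cluster_partition`, `WFA.isSSRI_of_clampDiff_eq`).

Part (b) starts with the baseline run alone and depth `|S| - 1`; as long as the second alternative
occurs, the depth decreases.
-/

/-! ### Runs and minimal weights -/

namespace LetterTrans

variable {Q : Type u}

theorem runWt_append (s : AugState Q) (w w' : List (LetterTrans Q)) (π π' : List (AugState Q))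
    (h : π.length = w.length) :
    runWt s (w ++ w') (π ++ π') = runWt s w π + runWt (endState s π) w' π' := by
  induction w generalizing s π with
  | nil =>
    obtain rfl : π = [] := by simpa using h
    simp [runWt, endState]
  | cons M w ih =>
    cases π with
    | nil => simp at h
    | cons r π =>
      simp only [List.cons_append, runWt, endState]
      rw [ih r π (by simpa using h), add_assoc]

theorem endState_append (s : AugState Q) (π π' : List (AugState Q)) :
    endState s (π ++ π') = endState (endState s π) π' := by
  induction π generalizing s with
  | nil => rfl
  | cons r π ih => exact ih r

theorem length_eq_of_runWt_ne_top {s : AugState Q} {w : List (LetterTrans Q)}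
    {π : List (AugState Q)} (h : runWt s w π ≠ ⊤) : π.length = w.length := by
  induction w generalizing s π with
  | nil => cases π with
    | nil => rfl
    | cons r π => simp [runWt] at h
  | cons M w ih => cases π with
    | nil => simp [runWt] at h
    | cons r π =>
      simp only [runWt, ne_eq, WithTop.add_eq_top, not_or] at h
      simp [ih h.2]

variable [Fintype Q] [DecidableEq Q]

@[simp] theorem maxeff_append (w w' : List (LetterTrans Q)) :
    maxeff (w ++ w') = maxeff w + maxeff w' := by
  simp [maxeff]

theorem maxeff_pow (w : List (LetterTrans Q)) (n : ℕ) : maxeff (pow w n) = n * maxeff w := by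
  induction n with
  | zero => simp [pow, maxeff]
  | succ n ih =>
    have : pow w (n + 1) = w ++ pow w n := by simp [pow, List.replicate_succ]
    rw [this, maxeff_append, ih]; ring

theorem abs_le_wmax {M : LetterTrans Q} {s r : AugState Q} {k : ℤ} (h : M s r = k) :
    |k| ≤ wmax M := by
  have := Finset.le_sup (f := fun p : AugState Q × AugState Q => ((M p.1 p.2).untopD 0).natAbs)
    (Finset.mem_univ (s, r))
  simp only [h, WithTop.untopD_coe] at this
  rw [Int.abs_eq_natAbs]
  exact_mod_cast this

theorem abs_runWt_le {s : AugState Q} {w : List (LetterTrans Q)} {π : List (AugState Q)} {k : ℤ}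
    (h : runWt s w π = k) : |k| ≤ maxeff w := by
  induction w generalizing s π k with
  | nil => cases π with
    | nil =>
      have : (0 : ℤ) = k := by simpa [runWt, eq_comm] using h
      simp [← this, maxeff]
    | cons r π => simp [runWt] at h
  | cons M w ih => cases π with
    | nil => simp [runWt] at h
    | cons r π =>
      simp only [runWt] at h
      obtain ⟨a, b, ha, hb, hab⟩ := WithTop.add_eq_coe.1 h
      have h1 := abs_le_wmax ha.symm
      have h2 := ih hb.symm
      have h3 : (maxeff (M :: w) : ℤ) = wmax M + maxeff w := by simp [maxeff]
      rw [h3, ← hab]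
      exact (abs_add_le a b).trans (add_le_add h1 h2)

theorem abs_mwt_le {s r : AugState Q} {w : List (LetterTrans Q)} {k : ℤ}
    (h : mwt w s r = k) : |k| ≤ maxeff w := by
  obtain ⟨π, -, h2⟩ := exists_runWt_eq_mwt w s r (by simp [h])
  exact abs_runWt_le (h2.trans h)

theorem mwt_append (w w' : List (LetterTrans Q)) (s r : AugState Q) :
    mwt (w ++ w') s r = Finset.univ.inf fun t => mwt w s t + mwt w' t r := by
  apply le_antisymm
  · refine Finset.le_inf fun t _ => ?_
    by_cases h1 : mwt w s t = ⊤
    · simp [h1]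
    by_cases h2 : mwt w' t r = ⊤
    · simp [h2]
    obtain ⟨π, e1, r1⟩ := exists_runWt_eq_mwt w s t h1
    obtain ⟨π', e2, r2⟩ := exists_runWt_eq_mwt w' t r h2
    have := mwt_le_runWt (w ++ w') s (π ++ π')
    rwa [endState_append, e1, e2, runWt_append _ _ _ _ _
      (length_eq_of_runWt_ne_top (r1 ▸ h1)), e1, r1, r2] at this
  · by_cases h : mwt (w ++ w') s r = ⊤
    · simp [h]
    obtain ⟨π, e, hr⟩ := exists_runWt_eq_mwt _ s r h
    have hl := length_eq_of_runWt_ne_top (hr ▸ h)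
    rw [← hr, ← List.take_append_drop w.length π, runWt_append _ _ _ _ _
      (by simp [hl])]
    refine (Finset.inf_le (Finset.mem_univ (endState s (π.take w.length)))).trans
      (add_le_add (mwt_le_runWt _ _ _) ?_)
    have := mwt_le_runWt w' (endState s (π.take w.length)) (π.drop w.length)
    rwa [← endState_append, List.take_append_drop, e] at this

theorem mwt_append_le (w w' : List (LetterTrans Q)) (s t r : AugState Q) :
    mwt (w ++ w') s r ≤ mwt w s t + mwt w' t r := by
  rw [mwt_append]; exact Finset.inf_le (Finset.mem_univ t)

theorem exists_mwt_append_eq (w w' : List (LetterTrans Q)) (s r : AugState Q) :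
    ∃ t, mwt (w ++ w') s r = mwt w s t + mwt w' t r := by
  obtain ⟨t, -, ht⟩ := Finset.exists_mem_eq_inf (Finset.univ : Finset (AugState Q)) ⟨s, by simp⟩
      (fun t => mwt w s t + mwt w' t r)
  exact ⟨t, (mwt_append w w' s r).trans ht⟩

theorem IsSeamless.take {s : AugState Q} {w : List (LetterTrans Q)} {π : List (AugState Q)}
    (h : IsSeamless s w π) (j : ℕ) : IsSeamless s (w.take j) (π.take j) := by
  obtain ⟨h1, h2, h3⟩ := h
  refine ⟨by simp [h1], ?_, fun k hk => ?_⟩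
  · intro h4
    rw [← List.take_append_drop j w, ← List.take_append_drop j π,
      runWt_append _ _ _ _ _ (by simp [h1]), h4, top_add] at h2
    exact h2 rfl
  · have : k ≤ w.length := hk.trans (by simp)
    have hkj : k ≤ j := hk.trans (by simp)
    simpa [List.take_take, hkj] using h3 k this

/-- A run of minimal weight is seamless: a cheaper run to an intermediate state could be completed
to a cheaper run. -/
theorem exists_isSeamless {s r : AugState Q} {w : List (LetterTrans Q)} (h : mwt w s r ≠ ⊤) :
    ∃ π, IsSeamless s w π ∧ endState s π = r := by
  obtain ⟨π, e, hr⟩ := exists_runWt_eq_mwt w s r h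
  have hne : runWt s w π ≠ ⊤ := hr ▸ h
  have hl := length_eq_of_runWt_ne_top hne
  refine ⟨π, ⟨hl, hne, fun j hj => le_antisymm ?_ (mwt_le_runWt _ _ _)⟩, e⟩
  have hsplit : runWt s w π = runWt s (w.take j) (π.take j) +
      runWt (endState s (π.take j)) (w.drop j) (π.drop j) := by
    conv_lhs => rw [← List.take_append_drop j w, ← List.take_append_drop j π]
    exact runWt_append _ _ _ _ _ (by simp [hl])
  have h1 := mwt_append_le (w.take j) (w.drop j) s (endState s (π.take j)) r
  have h2 := mwt_le_runWt (w.drop j) (endState s (π.take j)) (π.drop j)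
  rw [← endState_append, List.take_append_drop, e] at h2
  rw [List.take_append_drop, ← hr] at h1
  have h3 := h1.trans (add_le_add le_rfl h2)
  rw [hsplit] at h3 hne
  simp only [ne_eq, WithTop.add_eq_top, not_or] at hne
  exact WithTop.le_of_add_le_add_right hne.2 h3

end LetterTrans

namespace WFA

open LetterTrans CactusLetter

variable {Q : Type u} {α : Type v} [Fintype Q] [DecidableEq Q]

theorem wordTrans_eq_map (A : WFA Q α) (w : List (CactusLetter Q α)) :
    A.wordTrans w = w.map A.letterTrans := by
  induction w with
  | nil => simp [wordTrans]
  | cons a w ih => simp [wordTrans, ih]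

@[simp] theorem wordTrans_append (A : WFA Q α) (w w' : List (CactusLetter Q α)) :
    A.wordTrans (w ++ w') = A.wordTrans w ++ A.wordTrans w' := by
  simp [wordTrans_eq_map]

@[simp] theorem length_wordTrans (A : WFA Q α) (w : List (CactusLetter Q α)) :
    (A.wordTrans w).length = w.length := by
  simp [wordTrans_eq_map]

theorem wordEff_le_mul (A : WFA Q α) {w : List (CactusLetter Q α)} {K : ℕ}
    (h : ∀ a ∈ w, wmax (A.letterTrans a) ≤ K) : A.wordEff w ≤ w.length * K := by
  have := List.sum_le_card_nsmul ((A.wordTrans w).map wmax) K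
    (by simpa [wordTrans_eq_map] using h)
  simpa [wordEff, maxeff] using this

/-- The weight, as an integer, that the run `π` has accumulated after reading `w`. It is meaningful
for runs `π` on words with prefix `w`. -/
noncomputable def runVal (A : WFA Q α) (w : List (CactusLetter Q α)) (π : List (AugState Q)) : ℤ :=
  (runWt A.augInit (A.wordTrans w) (π.take w.length)).untopD 0

variable {A : WFA Q α} {w x : List (CactusLetter Q α)} {π : List (AugState Q)}

theorem IsRunSeamless.of_append (h : A.IsRunSeamless (w ++ x) π) :
    A.IsRunSeamless w (π.take w.length) := by
  have := IsSeamless.take h w.length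
  rwa [wordTrans_append, List.take_left' (by simp)] at this

theorem IsRunSeamless.length_eq (h : A.IsRunSeamless w π) : π.length = w.length := by
  simpa using h.1

theorem IsRunSeamless.runWt_eq (h : A.IsRunSeamless (w ++ x) π) :
    runWt A.augInit (A.wordTrans w) (π.take w.length) = A.runVal w π := by
  have h1 := h.of_append.2.1
  rw [runVal]
  generalize runWt A.augInit (A.wordTrans w) (π.take w.length) = z at h1
  cases z with
  | top => exact absurd rfl h1
  | coe k => rfl

theorem IsRunSeamless.conf_eq (h : A.IsRunSeamless (w ++ x) π) :
    A.conf w (endState A.augInit (π.take w.length)) = A.runVal w π := by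
  rw [← h.runWt_eq]
  have h1 := h.of_append
  have h2 := h1.2.2 (A.wordTrans w).length le_rfl
  rw [List.take_length] at h2
  have h3 : (π.take w.length).take (A.wordTrans w).length = π.take w.length := by
    simp [List.take_take]
  rw [h3] at h2
  exact h2.symm

theorem IsRunSeamless.abs_runVal_sub_le {y : List (CactusLetter Q α)}
    (h : A.IsRunSeamless (w ++ x ++ y) π) :
    |A.runVal (w ++ x) π - A.runVal w π| ≤ A.wordEff x := by
  have h1 := h.runWt_eq
  have h2 := IsRunSeamless.runWt_eq (w := w) (x := x ++ y) (A := A) (π := π) (by simpa using h)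
  have hl := h.length_eq
  have h3 : π.take (w ++ x).length = π.take w.length ++ (π.drop w.length).take x.length := by
    rw [List.length_append, List.take_add]
  rw [h3, wordTrans_append, runWt_append _ _ _ _ _ (by simp [hl]), h2] at h1
  obtain ⟨a, b, ha, hb, hab⟩ := WithTop.add_eq_coe.1 h1
  have hb' := abs_runWt_le hb.symm
  have : a = A.runVal w π := by exact_mod_cast ha
  rw [← hab, this]
  simpa [wordEff] using hb'

theorem runVal_take {n : ℕ} (h : w.length ≤ n) : A.runVal w (π.take n) = A.runVal w π := by
  simp [runVal, List.take_take, h]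

theorem exists_isRunSeamless {s : AugState Q} (h : A.conf w s ≠ ⊤) :
    ∃ π, A.IsRunSeamless w π ∧ A.conf w s = A.runVal w π := by
  obtain ⟨π, h1, h2⟩ := exists_isSeamless h
  refine ⟨π, h1, ?_⟩
  have h3 := IsRunSeamless.conf_eq (A := A) (w := w) (x := []) (π := π)
    (by rw [List.append_nil]; exact h1)
  rwa [List.take_of_length_le (IsRunSeamless.length_eq h1).le, h2] at h3

theorem IsRunSeamless.exists_conf_ne_top (h : A.IsRunSeamless (w ++ x) π) :
    ∃ s, A.conf w s ≠ ⊤ :=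
  ⟨_, by rw [h.conf_eq]; simp⟩

end WFA

/-! ### The potential grows slowly -/

namespace WFA

open LetterTrans CactusLetter

variable {Q : Type u} {α : Type v} [Fintype Q] [DecidableEq Q]

theorem conf_append_le (A : WFA Q α) (w x : List (CactusLetter Q α)) (s r : AugState Q) :
    A.conf (w ++ x) r ≤ A.conf w s + mwt (A.wordTrans x) s r := by
  simpa [conf] using mwt_append_le (A.wordTrans w) (A.wordTrans x) A.augInit s r

theorem exists_conf_append_eq (A : WFA Q α) (w x : List (CactusLetter Q α)) (r : AugState Q) :
    ∃ s, A.conf (w ++ x) r = A.conf w s + mwt (A.wordTrans x) s r := by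
  simpa [conf] using exists_mwt_append_eq (A.wordTrans w) (A.wordTrans x) A.augInit r

theorem cacAlph_subset_cacRebJumpAlph (A : WFA Q α) (L : ℕ → ℕ) :
    A.cacAlph L ⊆ A.cacRebJumpAlph L :=
  fun _ h => Or.inl (Or.inl h)

theorem isMinState_pow_nil (S' : Finset (AugState Q)) {s : AugState Q} (hs : s ∈ S') (n : ℕ) :
    IsMinState S' (pow [] n) s := by
  have hp : pow ([] : List (LetterTrans Q)) n = [] := by simp [pow]
  simp only [IsMinState, IsRefState, hp, mwt]
  exact ⟨⟨hs, by simp⟩, fun r _ => by simp⟩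

/-- Every state can read the cactus letter over the empty word, on the set of all states with the
same baseline component and the same reachable set. -/
theorem exists_cacRebCacAlph_readable (A : WFA Q α) (L : ℕ → ℕ) (q : AugState Q) :
    ∃ a ∈ A.cacRebCacAlph L, mwt (A.wordTrans [a]) q q ≠ ⊤ := by
  classical
  let S' : Finset (AugState Q) := Finset.univ.filter fun s => s.base = q.base ∧ s.reach = q.reach
  have hS : ∀ s, s ∈ S' ↔ s.base = q.base ∧ s.reach = q.reach := fun s => by simp [S']
  have hp : ∀ n, pow ([] : List (LetterTrans Q)) n = [] := fun n => by simp [pow]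
  have hw : A.wordTrans [] = [] := by simp [wordTrans]
  refine ⟨.cactus S' [], ⟨S', [], by simp, by simp, ?_, rfl⟩, ?_⟩
  · let b : AugState Q := ⟨(q.base, q.base, q.reach), q.2.2, q.2.2⟩
    have hb : b ∈ S' := (hS b).2 ⟨rfl, rfl⟩
    rw [hw]
    refine ⟨b, rfl, fun s => hS s, fun s hs r hr => ?_, fun n => ⟨isMinState_pow_nil S' hb n, ?_⟩⟩
    · obtain rfl : s = r := by
        by_contra hne
        exact hr (if_neg hne)
      exact hs
    · simp [hp, mwt]
  · have hq : q ∈ S' := (hS q).2 ⟨rfl, rfl⟩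
    have hmin := isMinState_pow_nil S' hq (AugState.stabConst Q)
    have hself : mwt (pow ([] : List (LetterTrans Q)) (AugState.stabConst Q)) q q = 0 := by
      simp [hp, mwt]
    have hg : IsGrounded S' [] q q := ⟨hq, hq, q, hmin, by simp [hself], by simp [hself]⟩
    have hle : LetterTrans.cactus S' [] q q ≤ 0 := by
      rw [LetterTrans.cactus, if_pos hg]
      refine (Finset.inf_le (Finset.mem_filter.2 ⟨Finset.mem_univ q, hmin⟩)).trans ?_
      simp [hself]
    have htr : A.wordTrans [.cactus S' []] = [LetterTrans.cactus S' []] := by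
      simp [wordTrans, letterTrans]
    rw [htr]
    refine ne_of_lt (lt_of_le_of_lt ?_ (WithTop.coe_lt_top (0 : ℤ)))
    refine (Finset.inf_le (Finset.mem_univ q)).trans ?_
    simpa [mwt] using hle

variable [Fintype α]

theorem finite_dominant_values (A : WFA Q α) (c : AugState Q → WithTop ℤ) :
    {k : ℤ | ∃ q, A.IsDominant c q ∧ c q = k}.Finite := by
  refine (Set.finite_range fun q => (c q).untopD 0).subset ?_
  rintro k ⟨q, -, hq⟩
  exact ⟨q, by simp [hq]⟩

/-- Among the states that can read a suffix from the set defining dominance, a lowest one is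
dominant. -/
theorem exists_isDominant (A : WFA Q α) {c : AugState Q → WithTop ℤ} {z : List (CactusLetter Q α)}
    {a : CactusLetter Q α} (hz : ∀ b ∈ z, b ∈ A.cacRebJumpAlph A.Lsimp)
    (ha : a ∈ A.cacRebCacAlph A.Lgen) {q : AugState Q} (hq : c q ≠ ⊤)
    (hr : ∃ r, mwt (A.wordTrans (z ++ [a])) q r ≠ ⊤) :
    ∃ p, A.IsDominant c p ∧ ∃ r, mwt (A.wordTrans (z ++ [a])) p r ≠ ⊤ := by
  classical
  obtain ⟨p, hp, hmin⟩ := Finset.exists_min_image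
    (Finset.univ.filter fun p => ∃ r, mwt (A.wordTrans (z ++ [a])) p r ≠ ⊤) c ⟨q, by simpa using hr⟩
  simp only [Finset.mem_filter, Finset.mem_univ, true_and] at hp hmin
  refine ⟨p, ⟨fun h => hq ?_, z, a, hz, ha, hp, fun p' hp' r => ?_⟩, hp⟩
  · exact top_le_iff.1 (h ▸ hmin q hr)
  · by_contra hne
    exact absurd hp' (not_lt.2 (hmin p' ⟨r, hne⟩))

/-- The potential is attained by a dominant state. -/
theorem exists_isDominant_eq_domVal (A : WFA Q α) {c : AugState Q → WithTop ℤ}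
    (hc : ∃ q, c q ≠ ⊤) : ∃ q, A.IsDominant c q ∧ c q = A.domVal c := by
  obtain ⟨q, hq⟩ := hc
  obtain ⟨a, ha, har⟩ := A.exists_cacRebCacAlph_readable A.Lgen q
  obtain ⟨p, hp, -⟩ := A.exists_isDominant (z := []) (by simp) ha hq ⟨q, har⟩
  obtain ⟨k, hk⟩ := WithTop.ne_top_iff_exists.1 hp.1
  have hne : {k : ℤ | ∃ q, A.IsDominant c q ∧ c q = k}.Nonempty := ⟨k, p, hp, hk.symm⟩
  exact Int.csSup_mem hne (A.finite_dominant_values c).bddAbove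

theorem le_domVal (A : WFA Q α) {c : AugState Q → WithTop ℤ} {q : AugState Q} {k : ℤ}
    (hq : A.IsDominant c q) (hk : c q = k) : k ≤ A.domVal c :=
  le_csSup (A.finite_dominant_values c).bddAbove ⟨q, hq, hk⟩

/-- Reading `x` raises the potential by at most the maximal effect of `x`. If `z a` makes a state
dominant after `x`, a lowest state from which `x z a` can be read is dominant before `x`; the state
that it leads to is not lower than the former one. -/
theorem potential_append_le (A : WFA Q α) {w x : List (CactusLetter Q α)}
    (hx : ∀ a ∈ x, a ∈ A.simpAlph) (hc : ∃ s, A.conf (w ++ x) s ≠ ⊤) :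
    A.potential (w ++ x) ≤ A.potential w + A.wordEff x := by
  obtain ⟨q, hdom, hq⟩ := A.exists_isDominant_eq_domVal hc
  obtain ⟨hq0, z, a, hz, ha, ⟨r, hr⟩, hlow⟩ := hdom
  obtain ⟨q', hq'⟩ := A.exists_conf_append_eq w x q
  rw [hq', ne_eq, WithTop.add_eq_top, not_or] at hq0
  have hread : ∃ r, mwt (A.wordTrans (x ++ z ++ [a])) q' r ≠ ⊤ := by
    refine ⟨r, fun h => ?_⟩
    have := mwt_append_le (A.wordTrans x) (A.wordTrans (z ++ [a])) q' q r
    rw [← wordTrans_append, ← List.append_assoc, h, top_le_iff, WithTop.add_eq_top] at this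
    exact this.elim hq0.2 hr
  obtain ⟨p, hp, t, ht⟩ := A.exists_isDominant (z := x ++ z) (fun b hb =>
    (List.mem_append.1 hb).elim (fun h => cacAlph_subset_cacRebJumpAlph A _ (hx b h)) (hz b))
    ha hq0.1 hread
  obtain ⟨k, hk⟩ := WithTop.ne_top_iff_exists.1 hp.1
  have hkp := A.le_domVal hp hk.symm
  rw [List.append_assoc, wordTrans_append] at ht
  obtain ⟨s, hs⟩ := exists_mwt_append_eq (A.wordTrans x) (A.wordTrans (z ++ [a])) p t
  rw [hs, ne_eq, WithTop.add_eq_top, not_or] at ht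
  obtain ⟨e, he⟩ := WithTop.ne_top_iff_exists.1 ht.1
  have he' := abs_mwt_le he.symm
  have hle : A.conf (w ++ x) q ≤ A.conf (w ++ x) s := by
    by_contra hcon
    exact ht.2 (hlow s (not_le.1 hcon) t)
  have h1 := hle.trans (A.conf_append_le w x p s)
  rw [hq, ← hk, ← he] at h1
  have h2 : A.domVal (A.conf (w ++ x)) ≤ k + e := by exact_mod_cast h1
  have h3 := le_abs_self e
  simp only [potential, wordEff]
  linarith

end WFA

/-! ### The recursive bounds -/

namespace BoundParams

variable (P : BoundParams)

theorem len_zero (i : ℕ) : P.len 0 i = 1 := by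
  rw [len]

theorem len_succ {d i : ℕ} (hi : i ≤ P.N) :
    P.len (d + 1) i = 32 * P.m ^ 2 * (P.len d 1 * P.len (d + 1) (i + 1) *
      (ramseyNumber (P.typ (d + 1) i) 3 + 2) ^ (2 * P.amp (d + 1) i + 1)) := by
  rw [len, if_pos hi]; ring

theorem len_pos (hm : 0 < P.m) (d i : ℕ) : 0 < P.len d i := by
  cases d with
  | zero => simp [len_zero]
  | succ d =>
    by_cases hi : i ≤ P.N
    · rw [len_succ P hi]
      have := len_pos hm d 1
      have := len_pos hm (d + 1) (i + 1)
      positivity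
    · rw [len, if_neg hi]; exact one_pos
termination_by (d, P.N + 1 - i)
decreasing_by all_goals simp [Prod.lex_def]; try omega

theorem len_succ_le {d i : ℕ} (hm : 0 < P.m) (hi : i ≤ P.N) :
    P.len (d + 1) (i + 1) ≤ P.len (d + 1) i := by
  rw [len_succ P hi]
  have := P.len_pos hm d 1
  calc P.len (d + 1) (i + 1) ≤ P.len (d + 1) (i + 1) * (32 * P.m ^ 2 * P.len d 1 *
        (ramseyNumber (P.typ (d + 1) i) 3 + 2) ^ (2 * P.amp (d + 1) i + 1)) :=
        Nat.le_mul_of_pos_right _ (by positivity)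
    _ = _ := by ring

theorem len_le_len_one {d i : ℕ} (hm : 0 < P.m) (h1 : 1 ≤ i) (hi : i ≤ P.N) :
    P.len (d + 1) i ≤ P.len (d + 1) 1 := by
  induction i, h1 using Nat.le_induction with
  | base => exact le_rfl
  | succ i h1 ih => exact (P.len_succ_le hm (by omega)).trans (ih (by omega))

theorem cov_succ {d i : ℕ} (hi : i < P.N) :
    P.cov (d + 1) i = 8 * P.m ^ 2 * (P.maxW d * P.len d 1 * P.len (d + 1) (i + 1) +
      P.cov (d + 1) (i + 1) + P.H) := by
  rw [cov, if_pos hi]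

theorem cov_pos (hm : 0 < P.m) (d i : ℕ) : 0 < P.cov d i := by
  cases d with
  | zero => simp [cov]
  | succ d =>
    by_cases hi : i < P.N
    · rw [cov_succ P hi]
      have := cov_pos hm (d + 1) (i + 1)
      positivity
    · rw [cov, if_neg hi]; exact one_pos
termination_by P.N + 1 - i

theorem amp_succ {d i : ℕ} (hi : i ≤ P.N) :
    P.amp (d + 1) i = 32 * P.m ^ 2 * (P.H + 2 * P.maxW d) *
      (ramseyNumber (P.typ (d + 1) i) 3 + P.len (d + 1) (i + 1) + P.len d 1) := by
  rw [amp, if_pos hi]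

theorem typ_eq (d i : ℕ) : P.typ d i = 3 ^ i * (2 * P.cov d i + 2) ^ (2 * P.N * i) := by
  rw [typ]

theorem maxW_succ (d : ℕ) : P.maxW (d + 1) = 2 * P.m * P.maxW d * P.len (d + 1) P.ι := by
  rw [maxW]

theorem maxW_mono (hm : 0 < P.m) : Monotone P.maxW := by
  refine monotone_nat_of_le_succ fun d => ?_
  rw [maxW_succ]
  have := P.len_pos hm (d + 1) P.ι
  calc P.maxW d ≤ P.maxW d * (2 * P.m * P.len (d + 1) P.ι) :=
        Nat.le_mul_of_pos_right _ (by positivity)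
    _ = _ := by ring

end BoundParams

namespace CactusLetter

variable {Q : Type u} {α : Type v}

theorem depth_le_wordDepth {a : CactusLetter Q α} {w : List (CactusLetter Q α)} (h : a ∈ w) :
    depth a ≤ wordDepth w := by
  induction w with
  | nil => simp at h
  | cons b w ih =>
    rw [wordDepth]
    rcases List.mem_cons.1 h with rfl | h
    · exact le_max_left _ _
    · exact (ih h).trans (le_max_right _ _)

theorem wordDepth_le {w : List (CactusLetter Q α)} {d : ℕ} (h : ∀ a ∈ w, depth a ≤ d) :
    wordDepth w ≤ d := by
  induction w with
  | nil => simp [wordDepth]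
  | cons b w ih =>
    rw [wordDepth]
    exact max_le (h b (by simp)) (ih fun a ha => h a (by simp [ha]))

end CactusLetter

theorem AugState.card_le_stabConst {Q : Type u} [Fintype Q] [DecidableEq Q] :
    Fintype.card (AugState Q) ≤ stabConst Q :=
  Nat.le_mul_of_pos_right _ (Nat.factorial_pos _)

namespace LetterTrans

variable {Q : Type u} [Fintype Q] [DecidableEq Q]

theorem wmax_cactus_le (S' : Finset (AugState Q)) (w : List (LetterTrans Q)) :
    wmax (cactus S' w) ≤ 2 * AugState.stabConst Q * maxeff w := by
  classical
  refine Finset.sup_le fun ⟨s, r⟩ _ => ?_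
  rw [cactus]
  split_ifs with hg
  · obtain ⟨g0, hg0⟩ := hg.2.2
    obtain ⟨g, -, hgr⟩ := Finset.exists_mem_eq_inf
      (Finset.univ.filter fun g => IsMinState S' (pow w (AugState.stabConst Q)) g)
      ⟨g0, by simpa using hg0.1⟩
      (fun g => mwt (pow w (AugState.stabConst Q)) s g + mwt (pow w (AugState.stabConst Q)) g r)
    rw [hgr]
    generalize hz : mwt (pow w (AugState.stabConst Q)) s g +
      mwt (pow w (AugState.stabConst Q)) g r = z
    cases z with
    | top => simp
    | coe k =>
      obtain ⟨a, b, ha, hb, hab⟩ := WithTop.add_eq_coe.1 hz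
      have h1 := abs_mwt_le ha.symm
      have h2 := abs_mwt_le hb.symm
      have h3 := abs_add_le a b
      rw [maxeff_pow] at h1 h2
      rw [hab, Int.abs_eq_natAbs] at h3
      simp only [WithTop.untopD_coe]
      push_cast at h1 h2
      zify
      rw [Int.abs_eq_natAbs]
      linarith
  · simp

end LetterTrans

namespace WFA

open LetterTrans CactusLetter

variable {Q : Type u} {α : Type v} [Fintype Q] [DecidableEq Q]

theorem stabConst_pos (A : WFA Q α) : 0 < AugState.stabConst Q :=
  Nat.mul_pos (Fintype.card_pos_iff.2 ⟨A.augInit⟩) (Nat.factorial_pos _)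

variable [Fintype α]

/-- The weights on a letter of depth `d` of the simple alphabet are at most `MaxWt(d)`. -/
theorem wmax_le_maxW (A : WFA Q α) {a : CactusLetter Q α} (h : A.IsBounded A.Lsimp a) :
    wmax (A.letterTrans a) ≤ A.simpParams.maxW (depth a) := by
  induction h with
  | base p a q =>
    rw [depth, BoundParams.maxW, letterTrans]
    exact Finset.le_sup (f := fun t : Q × α × Q => wmax (A.baseTrans t.1 t.2.1 t.2.2))
      (Finset.mem_univ (p, a, q))
  | cactus S' w hw hlen hst hnd ih =>
    rw [letterTrans, depth, add_comm, BoundParams.maxW_succ]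
    rw [depth, add_comm] at hlen
    have h1 : A.wordEff w ≤ w.length * A.simpParams.maxW (wordDepth w) :=
      A.wordEff_le_mul fun b hb => (ih b hb).trans
        (A.simpParams.maxW_mono A.stabConst_pos (depth_le_wordDepth hb))
    have h2 : w.length ≤ A.simpParams.len (wordDepth w + 1) A.simpParams.ι := hlen
    calc _ ≤ 2 * AugState.stabConst Q * A.wordEff w := wmax_cactus_le S' _
      _ ≤ 2 * AugState.stabConst Q * (A.simpParams.len (wordDepth w + 1) A.simpParams.ι *
          A.simpParams.maxW (wordDepth w)) :=
        Nat.mul_le_mul_left _ (h1.trans (Nat.mul_le_mul_right _ h2))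
      _ = _ := by
        change _ = 2 * AugState.stabConst Q * _ * _
        ring

theorem wordEff_le_maxW (A : WFA Q α) {w : List (CactusLetter Q α)} {d : ℕ}
    (h : ∀ a ∈ w, a ∈ A.simpAlph) (hd : wordDepth w ≤ d) :
    A.wordEff w ≤ w.length * A.simpParams.maxW d :=
  A.wordEff_le_mul fun a ha => (A.wmax_le_maxW (h a ha).1).trans
    (A.simpParams.maxW_mono A.stabConst_pos ((depth_le_wordDepth ha).trans hd))

end WFA

/-! ### Times at which a slowly growing function is high -/

/-- The length of the intervals on which `exists_level_times` finds its times when the function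
takes `k` values there. -/
def levelSpan (ρ b : ℕ) : ℕ → ℕ
  | 0 => 0
  | k + 1 => ρ * (levelSpan ρ b k + b)

theorem levelSpan_add_le {ρ b B : ℕ} (hb : b ≤ B) (k : ℕ) :
    levelSpan ρ b k + b ≤ B * (ρ + 2) ^ k := by
  induction k with
  | zero => simpa [levelSpan] using hb
  | succ k ih =>
    have h1 : B ≤ B * (ρ + 2) ^ k := Nat.le_mul_of_pos_right _ (by positivity)
    calc levelSpan ρ b (k + 1) + b ≤ ρ * (B * (ρ + 2) ^ k) + B * (ρ + 2) ^ k :=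
          add_le_add (Nat.mul_le_mul_left ρ ih) (hb.trans h1)
      _ ≤ B * (ρ + 2) ^ (k + 1) := by rw [pow_succ]; nlinarith

/-- A function with values among `k` consecutive integers on a long interval attains its maximum over some subinterval
at `ρ` times that are pairwise at least `b` apart: if some part of the interval misses the maximum,
then only `k - 1` values are left there. -/
theorem exists_level_times (φ : ℕ → ℤ) (ρ b : ℕ) (k a : ℕ) (M : ℤ)
    (h : ∀ t, a ≤ t → t ≤ a + levelSpan ρ b k → M - k < φ t ∧ φ t ≤ M) :
    ∃ (f : ℕ → ℕ) (M' : ℤ),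
      (∀ j < ρ, a + b ≤ f j ∧ f j ≤ a + levelSpan ρ b k ∧ φ (f j) = M' ∧
        ∀ e ≤ b, φ (f j - e) ≤ M') ∧
      ∀ j j', j < j' → j' < ρ → f j + b ≤ f j' := by
  induction k generalizing a M with
  | zero =>
    have := h a le_rfl (by simp)
    simp at this
    omega
  | succ k ih =>
    set Y := levelSpan ρ b k with hY
    have hspan : levelSpan ρ b (k + 1) = ρ * (Y + b) := rfl
    have hend : ∀ j < ρ, a + b + j * (Y + b) + Y ≤ a + levelSpan ρ b (k + 1) := by
      intro j hj
      have : (j + 1) * (Y + b) ≤ ρ * (Y + b) := Nat.mul_le_mul_right _ hj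
      rw [hspan]; linarith
    by_cases hM : ∀ j < ρ, ∃ t, a + b + j * (Y + b) ≤ t ∧ t ≤ a + b + j * (Y + b) + Y ∧ φ t = M
    · choose! f hf using hM
      refine ⟨f, M, fun j hj => ?_, fun j j' hjj hj' => ?_⟩
      · obtain ⟨h1, h2, h3⟩ := hf j hj
        have := hend j hj
        exact ⟨by omega, by omega, h3, fun e he => (h _ (by omega) (by omega)).2⟩
      · have h1 := (hf j (hjj.trans hj')).2.1
        have h2 := (hf j' hj').1
        have : (j + 1) * (Y + b) ≤ j' * (Y + b) := Nat.mul_le_mul_right _ hjj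
        linarith
    · push Not at hM
      obtain ⟨j, hj, hM⟩ := hM
      have hj2 := hend j hj
      obtain ⟨f, M', hf, hf'⟩ := ih (a + b + j * (Y + b)) (M - 1) fun t h1 h2 => by
        have h3 := h t (by omega) (by omega)
        have h4 := hM t h1 h2
        push_cast at h3
        omega
      refine ⟨f, M', fun i hi => ?_, hf'⟩
      obtain ⟨h1, h2, h3⟩ := hf i hi
      exact ⟨by omega, by omega, h3⟩

/-- A function that grows slowly, but by a lot between `s` and `t`, has `ρ` successive record times,
the times at which it first reaches the levels `φ s + W * b + 2 * W * (j + 1)`.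
The first level is not reached within `b` steps, and a level is overshot by less than `W`. -/
theorem exists_ramp_times (φ : ℕ → ℤ) (ρ b W n s t : ℕ)
    (hstep : ∀ r < n, φ (r + 1) ≤ φ r + W) (hst : s ≤ t) (htn : t ≤ n)
    (h : W * b + 2 * W * ρ < φ t - φ s) :
    ∃ f : ℕ → ℕ,
      (∀ j < ρ, b ≤ f j ∧ f j ≤ n ∧ ∀ e ≤ b, φ (f j - e) ≤ φ (f j)) ∧
      ∀ j j', j < j' → j' < ρ → f j < f j' ∧ φ (f j) + W < φ (f j') := by
  classical
  have hgrow : ∀ r, s + r ≤ n → φ (s + r) ≤ φ s + W * r := by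
    intro r
    induction r with
    | zero => simp
    | succ r ih =>
      intro hr
      have h1 := ih (by omega)
      have h2 := hstep (s + r) (by omega)
      push_cast
      rw [← add_assoc]
      linarith
  have hW : 0 < W := by
    rcases Nat.eq_zero_or_pos W with h0 | h0
    · have := hgrow (t - s) (by omega)
      rw [Nat.add_sub_cancel' hst, h0] at this
      simp [h0] at h this
      omega
    · exact h0
  set v : ℕ → ℤ := fun j => φ s + W * b + 2 * W * (j + 1) with hv
  have hex : ∀ j < ρ, ∃ r, v j ≤ φ (s + r) := fun j hj => ⟨t - s, by
    rw [Nat.add_sub_cancel' hst]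
    have : (W : ℤ) * (j + 1) ≤ W * ρ := by
      have : (j : ℤ) + 1 ≤ ρ := by exact_mod_cast hj
      nlinarith
    simp only [hv]; linarith⟩
  choose! g hg using fun j hj => (⟨Nat.find (hex j hj), Nat.find_spec (hex j hj),
    fun r hr => not_le.1 (Nat.find_min (hex j hj) hr)⟩ :
      ∃ r, v j ≤ φ (s + r) ∧ ∀ r' < r, φ (s + r') < v j)
  have hgt : ∀ j < ρ, s + g j ≤ t := by
    intro j hj
    by_contra hcon
    have h1 := (hg j hj).2 (t - s) (by omega)
    rw [Nat.add_sub_cancel' hst] at h1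
    have : (W : ℤ) * (j + 1) ≤ W * ρ := by
      have : (j : ℤ) + 1 ≤ ρ := by exact_mod_cast hj
      nlinarith
    simp only [hv] at h1; linarith
  have hgb : ∀ j < ρ, b < g j := by
    intro j hj
    have h1 := hgrow (g j) ((hgt j hj).trans htn)
    have h2 := (hg j hj).1
    have h3 : (W : ℤ) * b < W * g j := by
      have : (0 : ℤ) < W * (j + 1) := by positivity
      simp only [hv] at h2; linarith
    exact_mod_cast lt_of_mul_lt_mul_left h3 (by positivity)
  have hub : ∀ j < ρ, φ (s + g j) < v j + W := by
    intro j hj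
    have h0 := hgb j hj
    have h1 := (hg j hj).2 (g j - 1) (by omega)
    have h2 := hstep (s + (g j - 1)) (by have := hgt j hj; omega)
    rw [add_assoc, Nat.sub_add_cancel (by omega)] at h2
    linarith
  refine ⟨fun j => s + g j, fun j hj => ⟨?_, (hgt j hj).trans htn, fun e he => ?_⟩, ?_⟩
  · have := hgb j hj
    change b ≤ s + g j
    omega
  · have h0 := hgb j hj
    rcases Nat.eq_zero_or_pos e with rfl | he0
    · simp
    · have h1 := (hg j hj).2 (g j - e) (by omega)
      rw [← Nat.add_sub_assoc (by omega)] at h1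
      exact h1.le.trans (hg j hj).1
  · intro j j' hjj hj'
    have hj := hjj.trans hj'
    have h1 := hub j hj
    have h2 := (hg j' hj').1
    have h3 : φ (s + g j) + W < φ (s + g j') := by
      have : (W : ℤ) * (j + 1) ≤ W * j' := by
        have : (j : ℤ) + 1 ≤ j' := by exact_mod_cast hjj
        nlinarith
      simp only [hv] at h1 h2
      linarith
    refine ⟨?_, h3⟩
    change s + g j < s + g j'
    by_contra hcon
    rcases eq_or_lt_of_le (not_lt.1 hcon) with h4 | h4
    · rw [h4] at h3
      linarith [(Nat.cast_nonneg W : (0 : ℤ) ≤ W)]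
    · have h5 := (hg j hj).2 (g j') (by omega)
      have h6 := (hg j hj).1
      linarith [(Nat.cast_nonneg W : (0 : ℤ) ≤ W)]

/-- A function that grows slowly and ends at least as high as it started has `ρ` successive times
at which it is at least as high as at the `b` preceding ones, and between which it either stays
level or rises by more than a single step can. -/
theorem exists_record_times (φ : ℕ → ℤ) (ρ b B W A n : ℕ)
    (hstep : ∀ r < n, φ (r + 1) ≤ φ r + W) (h0n : φ 0 ≤ φ n)
    (hn : n = B * (ρ + 2) ^ (2 * A + 1)) (hb : 1 ≤ b) (hbB : b ≤ B)
    (hA : W * b + 2 * W * ρ ≤ A) :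
    ∃ f : ℕ → ℕ,
      (∀ j < ρ, b ≤ f j ∧ f j ≤ n ∧ ∀ e ≤ b, φ (f j - e) ≤ φ (f j)) ∧
      (∀ j j', j < j' → j' < ρ → f j < f j') ∧
      ((∀ j j', j < j' → j' < ρ → φ (f j) = φ (f j') ∧ f j + b ≤ f j') ∨
        ∀ j j', j < j' → j' < ρ → φ (f j) + W < φ (f j')) := by
  by_cases hr : ∃ s t, s ≤ t ∧ t ≤ n ∧ (A : ℤ) < φ t - φ s
  · obtain ⟨s, t, hst, htn, hr⟩ := hr
    obtain ⟨f, h1, h2⟩ := exists_ramp_times φ ρ b W n s t hstep hst htn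
      (lt_of_le_of_lt (by exact_mod_cast hA) hr)
    exact ⟨f, h1, fun j j' h h' => (h2 j j' h h').1, Or.inr fun j j' h h' => (h2 j j' h h').2⟩
  · push Not at hr
    have hspan := levelSpan_add_le (ρ := ρ) hbB (2 * A + 1)
    rw [← hn] at hspan
    -- all values lie between `φ 0 - A` and `φ 0 + A`
    obtain ⟨f, M', h1, h2⟩ := exists_level_times φ ρ b (2 * A + 1) 0 (φ 0 + A) fun t _ ht => by
      have h3 := hr 0 t (by omega) (by omega)
      have h4 := hr t n (by omega) le_rfl
      push_cast
      omega
    refine ⟨f, fun j hj => ?_, fun j j' h h' => ?_, Or.inl fun j j' h h' => ⟨?_, h2 j j' h h'⟩⟩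
    · obtain ⟨h3, h4, h5, h6⟩ := h1 j hj
      exact ⟨by omega, by omega, h5 ▸ h6⟩
    · have := h2 j j' h h'
      omega
    · rw [(h1 j (h.trans h')).2.2.1, (h1 j' h').2.2.1]

/-! ### Ramsey's theorem for triangles -/

/-- A set with enough elements, the pairs of which are coloured with `k` colours, contains a
triangle all of whose edges have the same colour. -/
theorem exists_forall_mono_triangle (k : ℕ) : ∃ R : ℕ, ∀ (V K : Finset ℕ) (col : ℕ → ℕ → ℕ),
    K.card = k → R ≤ V.card → (∀ x ∈ V, ∀ y ∈ V, x < y → col x y ∈ K) →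
    ∃ x ∈ V, ∃ y ∈ V, ∃ z ∈ V, x < y ∧ y < z ∧ col x y = col y z ∧ col x y = col x z := by
  induction k with
  | zero =>
    refine ⟨2, fun V K col hK hV h => ?_⟩
    obtain rfl := Finset.card_eq_zero.1 hK
    obtain ⟨x, hx, y, hy, hxy⟩ := Finset.one_lt_card.1 hV
    rcases lt_or_gt_of_ne hxy with h1 | h1
    · simpa using h x hx y hy h1
    · simpa using h y hy x hx h1
  | succ k ih =>
    obtain ⟨R, hR⟩ := ih
    refine ⟨(k + 1) * R + 2, fun V K col hK hV h => ?_⟩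
    have hne : V.Nonempty := Finset.card_pos.1 (by omega)
    set v := V.min' hne with hv
    have hvV : v ∈ V := V.min'_mem hne
    have hlt : ∀ y ∈ V.erase v, v < y := fun y hy =>
      lt_of_le_of_ne (V.min'_le y (Finset.mem_of_mem_erase hy)) (Finset.ne_of_mem_erase hy).symm
    have hcard : K.card * R < (V.erase v).card := by
      rw [hK, Finset.card_erase_of_mem hvV]; omega
    -- the colour of most edges at the least vertex `v`
    obtain ⟨κ, hκ, hκR⟩ := Finset.exists_lt_card_fiber_of_mul_lt_card_of_maps_to
      (f := fun y => col v y) (fun y hy => h v hvV y (Finset.mem_of_mem_erase hy) (hlt y hy)) hcard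
    set U := (V.erase v).filter fun y => col v y = κ
    have hU : ∀ y ∈ U, y ∈ V ∧ v < y ∧ col v y = κ := fun y hy =>
      ⟨Finset.mem_of_mem_erase (Finset.mem_filter.1 hy).1, hlt y (Finset.mem_filter.1 hy).1,
        (Finset.mem_filter.1 hy).2⟩
    by_cases hc : ∃ y ∈ U, ∃ z ∈ U, y < z ∧ col y z = κ
    · obtain ⟨y, hy, z, hz, hyz, hcol⟩ := hc
      obtain ⟨hyV, hvy, hyc⟩ := hU y hy
      obtain ⟨hzV, hvz, hzc⟩ := hU z hz
      exact ⟨v, hvV, y, hyV, z, hzV, hvy, hyz, by rw [hyc, hcol], by rw [hyc, hzc]⟩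
    · push Not at hc
      obtain ⟨x, hx, y, hy, z, hz, hr⟩ := hR U (K.erase κ) col
        (by rw [Finset.card_erase_of_mem hκ, hK]; rfl) hκR.le fun x hx y hy hxy =>
          Finset.mem_erase.2 ⟨hc x hx y hy hxy, h x (hU x hx).1 y (hU y hy).1 hxy⟩
      exact ⟨x, (hU x hx).1, y, (hU y hy).1, z, (hU z hz).1, hr⟩

/-- The set of which `ramseyNumber k 3` is the infimum is not empty. -/
theorem exists_forall_ramsey (k : ℕ) : ∃ R : ℕ, ∀ c : {e : Finset (Fin R) // e.card = 2} → Fin k,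
    ∃ X : Finset (Fin R), 3 ≤ X.card ∧ ∀ e e', e.1 ⊆ X → e'.1 ⊆ X → c e = c e' := by
  classical
  obtain ⟨R, hR⟩ := exists_forall_mono_triangle k
  refine ⟨R, fun c => ?_⟩
  have hcard : ∀ x y : Fin R, x < y → ({x, y} : Finset (Fin R)).card = 2 := fun x y h =>
    Finset.card_pair h.ne
  let col : ℕ → ℕ → ℕ := fun x y =>
    if h : ∃ (hx : x < R) (hy : y < R), (⟨x, hx⟩ : Fin R) < ⟨y, hy⟩ then
      c ⟨{⟨x, h.1⟩, ⟨y, h.2.1⟩}, hcard _ _ h.2.2⟩ else 0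
  have hcol : ∀ (x y : Fin R) (h : x < y), col x y = c ⟨{x, y}, hcard x y h⟩ := fun x y h =>
    dif_pos ⟨x.2, y.2, h⟩
  obtain ⟨x, hx, y, hy, z, hz, hxy, hyz, h1, h2⟩ := hR (Finset.range R) (Finset.range k) col
    (by simp) (by simp) fun x hx y hy h => by
      have := hcol ⟨x, Finset.mem_range.1 hx⟩ ⟨y, Finset.mem_range.1 hy⟩ h
      simp only at this
      simp [this]
  rw [Finset.mem_range] at hx hy hz
  lift x to Fin R using hx
  lift y to Fin R using hy
  lift z to Fin R using hz
  rw [Fin.val_fin_lt] at hxy hyz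
  rw [hcol x y hxy, hcol y z hyz, Fin.val_inj] at h1
  rw [hcol x y hxy, hcol x z (hxy.trans hyz), Fin.val_inj] at h2
  have key : ∀ e : {e : Finset (Fin R) // e.card = 2}, e.1 ⊆ {x, y, z} →
      c e = c ⟨{x, y}, hcard x y hxy⟩ := by
    rintro ⟨e, he⟩ hsub
    obtain ⟨p, q, hpq, rfl⟩ : ∃ p q, p < q ∧ e = {p, q} := by
      obtain ⟨p, q, hpq, rfl⟩ := Finset.card_eq_two.1 he
      rcases lt_or_gt_of_ne hpq with h | h
      · exact ⟨p, q, h, rfl⟩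
      · exact ⟨q, p, h, Finset.pair_comm p q⟩
    have hp : p = x ∨ p = y ∨ p = z := by simpa using hsub (Finset.mem_insert_self p _)
    have hq : q = x ∨ q = y ∨ q = z := by
      simpa using hsub (Finset.mem_insert_of_mem (Finset.mem_singleton_self q))
    rcases hp with rfl | rfl | rfl <;> rcases hq with rfl | rfl | rfl <;>
      first
      | rfl
      | exact h1.symm
      | exact h2.symm
      | (exfalso; order)
  refine ⟨{x, y, z}, ?_, fun e e' he he' => (key e he).trans (key e' he').symm⟩
  rw [Finset.card_eq_three.2 ⟨x, y, z, hxy.ne, (hxy.trans hyz).ne, hyz.ne, rfl⟩]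

theorem exists_mono_triple {κ : Type*} [Fintype κ] {k : ℕ} (hk : Fintype.card κ = k)
    (col : ℕ → ℕ → κ) : ∃ x y z, x < y ∧ y < z ∧ z < ramseyNumber k 3 ∧
      col x y = col y z := by
  classical
  have hR := Nat.sInf_mem (exists_forall_ramsey k)
  change ramseyNumber k 3 ∈ _ at hR
  have hne : ∀ e : {e : Finset (Fin (ramseyNumber k 3)) // e.card = 2}, e.1.Nonempty := fun e =>
    Finset.card_pos.1 (by rw [e.2]; exact two_pos)
  obtain ⟨X, hX, hmono⟩ := hR fun e => Fintype.equivFinOfCardEq hk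
    (col (e.1.min' (hne e)) (e.1.max' (hne e)))
  obtain ⟨Y, hYX, hY⟩ := Finset.exists_subset_card_eq hX
  have hlt := (Y.orderEmbOfFin hY).strictMono
  have hmem : ∀ j, Y.orderEmbOfFin hY j ∈ X := fun j => hYX (Y.orderEmbOfFin_mem hY j)
  set x := Y.orderEmbOfFin hY 0
  set y := Y.orderEmbOfFin hY 1
  set z := Y.orderEmbOfFin hY 2
  have hxy : x < y := hlt (by decide)
  have hyz : y < z := hlt (by decide)
  have hpair : ∀ a b a' b' : Fin (ramseyNumber k 3), a ∈ X → b ∈ X → a' ∈ X → b' ∈ X →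
      a < b → a' < b' → col a b = col a' b' := by
    intro a b a' b' ha hb ha' hb' hab hab'
    have := hmono ⟨{a, b}, Finset.card_pair hab.ne⟩ ⟨{a', b'}, Finset.card_pair hab'.ne⟩
      (by simp [Finset.insert_subset_iff, ha, hb]) (by simp [Finset.insert_subset_iff, ha', hb'])
    simpa [Finset.min'_pair, Finset.max'_pair, hab.le, hab'.le] using this
  exact ⟨x, y, z, hxy, hyz, z.2, hpair _ _ _ _ (hmem 0) (hmem 1) (hmem 1) (hmem 2) hxy hyz⟩

/-! ### Configurations relative to widely separated runs -/

/-- The difference `x - r` if it is finite and at most `C` in absolute value, `none` otherwise. -/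
noncomputable def clampDiff (C : ℕ) (x : WithTop ℤ) (r : ℤ) :
    Option (Finset.Icc (-(C : ℤ)) C) :=
  if h : x ≠ ⊤ ∧ x.untopD 0 - r ∈ Finset.Icc (-(C : ℤ)) C then some ⟨_, h.2⟩ else none

theorem clampDiff_eq_some_iff {C : ℕ} {x : WithTop ℤ} {r : ℤ} {v : Finset.Icc (-(C : ℤ)) C} :
    clampDiff C x r = some v ↔ x = ((r + v : ℤ) : WithTop ℤ) := by
  unfold clampDiff
  split_ifs with h
  · cases x with
    | top => exact absurd rfl h.1
    | coe k =>
      rw [Option.some_inj, Subtype.ext_iff, WithTop.coe_inj]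
      change k - r = v ↔ _
      constructor <;> intro h <;> omega
  · refine ⟨fun h => by simp at h, ?_⟩
    rintro rfl
    exact absurd ⟨by simp, by simp⟩ h

theorem abs_coe_Icc_le {C : ℕ} (v : Finset.Icc (-(C : ℤ)) C) : |(v : ℤ)| ≤ C :=
  abs_le.2 (Finset.mem_Icc.1 v.2)

/-- Ramsey's theorem for positions of a word, where a pair of positions is coloured by the directions
in which the weights `g` of the runs change and by the configurations relative to the runs. -/
theorem exists_similar_positions {S ι : Type*} [Fintype S] [Fintype ι] (C : ℕ) {k : ℕ}
    (hk : 3 ^ Fintype.card ι * (2 * C + 2) ^ (2 * Fintype.card S * Fintype.card ι) = k)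
    (c : ℕ → S → WithTop ℤ) (g : ℕ → ι → ℤ) :
    ∃ x y z, x < y ∧ y < z ∧ z < ramseyNumber k 3 ∧
      (∀ π, (g y π - g x π).sign = (g z π - g y π).sign) ∧
      ∀ s π, clampDiff C (c y s) (g y π) = clampDiff C (c x s) (g x π) ∧
        clampDiff C (c z s) (g z π) = clampDiff C (c x s) (g x π) := by
  classical
  have h3 : Fintype.card SignType = 3 := rfl
  have hC : Fintype.card (Option (Finset.Icc (-(C : ℤ)) C)) = 2 * C + 2 := by
    rw [Fintype.card_option, Fintype.card_coe, Int.card_Icc]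
    omega
  have hcard : Fintype.card ((ι → SignType) × (ι → S → Option (Finset.Icc (-(C : ℤ)) C)) ×
      (ι → S → Option (Finset.Icc (-(C : ℤ)) C))) = k := by
    rw [Fintype.card_prod, Fintype.card_prod, Fintype.card_fun, Fintype.card_fun,
      Fintype.card_fun, hC, h3, ← hk, ← pow_mul, ← pow_add]
    ring_nf
  obtain ⟨x, y, z, hxy, hyz, hz, h1⟩ := exists_mono_triple hcard fun i j =>
    (fun π => SignType.sign (g j π - g i π), fun π s => clampDiff C (c i s) (g i π),
      fun π s => clampDiff C (c j s) (g j π))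
  simp only [Prod.mk.injEq] at h1
  refine ⟨x, y, z, hxy, hyz, hz, fun π => ?_, fun s π => ?_⟩
  · rw [Int.sign_eq_sign, Int.sign_eq_sign, congr_fun h1.1 π]
  · have a1 := congr_fun (congr_fun h1.2.1 π) s
    have a2 := congr_fun (congr_fun h1.2.2 π) s
    exact ⟨a1.symm, a2.symm.trans a1.symm⟩

/-- If each configuration splits into clusters around the runs of a finite family, the position of
each state relative to the runs being the same in the three configurations, then the clusters are
a partition into sets that move as a whole and remain far apart. -/
theorem exists_cluster_partition {S ι : Type*} [Fintype S] [DecidableEq S] [Fintype ι]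
    (C D G : ℕ) (c : Fin 3 → S → WithTop ℤ) (g : Fin 3 → ι → ℤ)
    (hrun : ∀ π, ∃ s, c 0 s = g 0 π)
    (hcov : ∀ s, c 0 s ≠ ⊤ → ∃ π, clampDiff C (c 0 s) (g 0 π) ≠ none)
    (htype : ∀ k s π, clampDiff C (c k s) (g k π) = clampDiff C (c 0 s) (g 0 π))
    (hD : ∀ k π, |g k π - g 0 π| ≤ D)
    (hsep : ∀ π π', π ≠ π' → 2 * (C : ℤ) + 2 * D + G < |g 0 π - g 0 π'|)
    (hsign : ∀ π, (g 1 π - g 0 π).sign = (g 2 π - g 1 π).sign) :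
    ∃ (l : ℕ) (V : Fin l → Finset S),
      (∀ j, (V j).Nonempty) ∧
      (∀ j j', j ≠ j' → Disjoint (V j) (V j')) ∧
      (∀ s, (∃ j, s ∈ V j) ↔ c 0 s ≠ ⊤) ∧
      (∀ j j' : Fin l, (j : ℕ) + 1 = j' → ∀ s ∈ V j, ∀ s' ∈ V j', ∀ k,
        c k s + (G : WithTop ℤ) < c k s') ∧
      ∀ j, ∃ kx ky : ℤ, kx.sign = ky.sign ∧ ∀ s ∈ V j,
        c 1 s = c 0 s + (kx : WithTop ℤ) ∧ c 2 s = c 1 s + (ky : WithTop ℤ) := by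
  classical
  have hinj : Function.Injective (g 0) := by
    intro π π' h
    by_contra hne
    have := hsep π π' hne
    rw [h, sub_self, abs_zero] at this
    omega
  -- the runs in the order of their weights in the first configuration
  set e := (Finset.univ.image (g 0)).orderEmbOfFin rfl with he
  have hex : ∀ j, ∃ π, g 0 π = e j := fun j => by
    simpa using Finset.mem_image.1 ((Finset.univ.image (g 0)).orderEmbOfFin_mem rfl j)
  choose p hp using hex
  have hsurj : ∀ π, ∃ j, p j = π := by
    intro π
    have : g 0 π ∈ Set.range e := by simp [he]
    obtain ⟨j, hj⟩ := this
    exact ⟨j, hinj ((hp j).trans hj)⟩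
  have hpne : ∀ j j', j ≠ j' → p j ≠ p j' := fun j j' hne h =>
    hne (e.injective (by rw [← hp j, ← hp j', h]))
  set V : Fin _ → Finset S := fun j => Finset.univ.filter fun s =>
    clampDiff C (c 0 s) (g 0 (p j)) ≠ none
  have hV : ∀ j s, s ∈ V j → ∃ v : ℤ, |v| ≤ C ∧ ∀ k, c k s = ((g k (p j) + v : ℤ) : WithTop ℤ) := by
    intro j s hs
    obtain ⟨v, hv⟩ := Option.ne_none_iff_exists'.1 (Finset.mem_filter.1 hs).2
    exact ⟨v, abs_coe_Icc_le v, fun k => clampDiff_eq_some_iff.1 ((htype k s (p j)).trans hv)⟩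
  refine ⟨_, V, fun j => ?_, fun j j' hne => ?_, fun s => ⟨?_, fun hs => ?_⟩, ?_, fun j => ?_⟩
  · obtain ⟨s, hs⟩ := hrun (p j)
    refine ⟨s, Finset.mem_filter.2 ⟨Finset.mem_univ s, ?_⟩⟩
    have : clampDiff C (c 0 s) (g 0 (p j)) = some ⟨0, by simp⟩ :=
      clampDiff_eq_some_iff.2 (by simp [hs])
    simp [this]
  · rw [Finset.disjoint_left]
    intro s hs hs'
    obtain ⟨v, hv, hv'⟩ := hV j s hs
    obtain ⟨v2, hv2, hv2'⟩ := hV j' s hs'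
    have h1 := hsep _ _ (hpne j j' hne)
    have h2 := (hv' 0).symm.trans (hv2' 0)
    rw [WithTop.coe_inj] at h2
    have h3 : g 0 (p j) - g 0 (p j') = v2 - v := by omega
    rw [h3] at h1
    have := abs_sub v2 v
    omega
  · rintro ⟨j, hj⟩
    obtain ⟨v, -, hv⟩ := hV j s hj
    simp [hv 0]
  · obtain ⟨π, hπ⟩ := hcov s hs
    obtain ⟨j, rfl⟩ := hsurj π
    exact ⟨j, Finset.mem_filter.2 ⟨Finset.mem_univ s, hπ⟩⟩
  · intro j j' hjj s hs s' hs' k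
    obtain ⟨v, hv, hv'⟩ := hV j s hs
    obtain ⟨v2, hv2, hv2'⟩ := hV j' s' hs'
    have hlt : j < j' := Fin.lt_def.2 (by omega)
    have h0 : g 0 (p j) < g 0 (p j') := by rw [hp, hp]; exact e.strictMono hlt
    have h1 := hsep _ _ (hpne j' j hlt.ne')
    rw [abs_of_pos (by omega)] at h1
    have h2 := abs_le.1 (hD k (p j))
    have h3 := abs_le.1 (hD k (p j'))
    have h4 := abs_le.1 hv
    have h5 := abs_le.1 hv2
    rw [hv' k, hv2' k]
    have : g k (p j) + v + (G : ℤ) < g k (p j') + v2 := by omega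
    exact_mod_cast this
  · refine ⟨_, _, hsign (p j), fun s hs => ?_⟩
    obtain ⟨v, -, hv⟩ := hV j s hs
    rw [hv 0, hv 1, hv 2]
    constructor
    · rw [← WithTop.coe_add, WithTop.coe_inj]; ring
    · rw [← WithTop.coe_add, WithTop.coe_inj]; ring

/-! ### Separated repeating infixes of well-separated words -/

namespace WFA

open LetterTrans CactusLetter

variable {Q : Type u} {α : Type v} [Fintype Q] [DecidableEq Q] [Fintype α]

/-- The number of letters of a word of length `Len(d + 1, i) / (32𝔪²)`. -/
theorem length_eq_of_simpLen (A : WFA Q α) {d i l : ℕ} (hi : i ≤ Fintype.card (AugState Q))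
    (h : 32 * AugState.stabConst Q ^ 2 * l = A.simpLen (d + 1) i) :
    l = A.simpLen d 1 * A.simpLen (d + 1) (i + 1) *
      (ramseyNumber (A.simpParams.typ (d + 1) i) 3 + 2) ^
        (2 * A.simpParams.amp (d + 1) i + 1) := by
  have hm := A.stabConst_pos
  rw [simpLen, BoundParams.len_succ A.simpParams hi] at h
  exact Nat.eq_of_mul_eq_mul_left (by positivity) h

/-- Three positions at which the configurations look alike relative to the given runs delimit a
separated repeating infix. -/
theorem isSSRI_of_clampDiff_eq (A : WFA Q α) {d i : ℕ}
    {w₁ p x y q w₃ : List (CactusLetter Q α)} {I : Finset (List (AugState Q))}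
    (hi1 : 1 ≤ i) (hi : i ≤ Fintype.card (AugState Q))
    (h : A.IsWellSeparated d i w₁ (p ++ x ++ y ++ q) w₃ I)
    (hlen : 32 * AugState.stabConst Q ^ 2 * (p ++ x ++ y ++ q).length = A.simpLen (d + 1) i)
    (hx : x ≠ []) (hy : y ≠ []) (hdep : wordDepth x = d)
    (hcov : ∀ z ∈ [p, p ++ x, p ++ x ++ y], ∀ s, A.conf (w₁ ++ z) s ≠ ⊤ → ∃ π ∈ I,
      clampDiff (A.simpCov (d + 1) i) (A.conf (w₁ ++ z) s) (A.runVal (w₁ ++ z) π) ≠ none)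
    (htype : ∀ z ∈ [p, p ++ x, p ++ x ++ y], ∀ s, ∀ π ∈ I,
      clampDiff (A.simpCov (d + 1) i) (A.conf (w₁ ++ z) s) (A.runVal (w₁ ++ z) π) =
      clampDiff (A.simpCov (d + 1) i) (A.conf (w₁ ++ p) s) (A.runVal (w₁ ++ p) π))
    (hsign : ∀ π ∈ I, (A.runVal (w₁ ++ (p ++ x)) π - A.runVal (w₁ ++ p) π).sign =
      (A.runVal (w₁ ++ (p ++ x ++ y)) π - A.runVal (w₁ ++ (p ++ x)) π).sign)
    (hpx : A.potential (w₁ ++ p) ≤ A.potential (w₁ ++ (p ++ x)))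
    (hpy : A.potential (w₁ ++ (p ++ x)) ≤ A.potential (w₁ ++ (p ++ x ++ y)))
    (hpi : A.potential (w₁ ++ p) = A.potential (w₁ ++ (p ++ x)) ↔
      A.potential (w₁ ++ (p ++ x)) = A.potential (w₁ ++ (p ++ x ++ y))) :
    A.IsSSRI (w₁ ++ p) x y (q ++ w₃) := by
  have hm := A.stabConst_pos
  have hsupp : ∀ z ∈ [p, p ++ x, p ++ x ++ y], ∀ s,
      A.conf (w₁ ++ z) s = ⊤ ↔ A.conf (w₁ ++ p) s = ⊤ := by
    intro z hz s
    rw [← not_iff_not]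
    constructor
    · intro hs
      obtain ⟨π, hπ, hne⟩ := hcov z hz s hs
      rw [htype z hz s π hπ] at hne
      obtain ⟨v, hv⟩ := Option.ne_none_iff_exists'.1 hne
      rw [clampDiff_eq_some_iff.1 hv]
      simp
    · intro hs
      obtain ⟨π, hπ, hne⟩ := hcov p (by simp) s hs
      rw [← htype z hz s π hπ] at hne
      obtain ⟨v, hv⟩ := Option.ne_none_iff_exists'.1 hne
      rw [clampDiff_eq_some_iff.1 hv]
      simp
  have halph : ∀ a ∈ w₁ ++ p ++ x ++ y ++ (q ++ w₃), a ∈ A.simpAlph := by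
    simpa [or_assoc] using h.mem_alph
  have heff : ∀ z, (∀ a ∈ z, a ∈ p ++ x ++ y ++ q) →
      A.wordEff z ≤ z.length * A.simpParams.maxW d := fun z hz =>
    A.wordEff_le_maxW (fun a ha => h.mem_alph a (by
      have := hz a ha
      simp only [List.mem_append] at this ⊢
      tauto)) (wordDepth_le fun a ha =>
        (depth_le_wordDepth (hz a ha)).trans h.depth_le)
  have hxy : A.wordEff (x ++ y) ≤ (p ++ x ++ y ++ q).length * A.simpParams.maxW d :=
    (heff _ fun a ha => by simp only [List.mem_append] at ha ⊢; tauto).trans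
      (Nat.mul_le_mul_right _ (by simp; omega))
  have hx' : A.wordEff x ≤ (p ++ x ++ y ++ q).length * A.simpParams.maxW d :=
    (heff _ fun a ha => by simp only [List.mem_append] at ha ⊢; tauto).trans
      (Nat.mul_le_mul_right _ (by simp; omega))
  set n := (p ++ x ++ y ++ q).length with hn
  refine ⟨halph, hx, hy, ?_, ?_, ?_, ?_, ?_, ?_, ?_, ?_⟩
  · simpa using hsupp (p ++ x) (by simp)
  · simpa using hsupp (p ++ x ++ y) (by simp)
  · have h1 : A.simpLen (d + 1) i ≤ A.Lsimp (wordDepth x + 1) := by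
      rw [hdep]; exact A.simpParams.len_le_len_one hm hi1 hi
    have h2 : x.length ≤ n := by simp [hn]; omega
    calc AugState.stabConst Q * x.length
        ≤ (32 * AugState.stabConst Q ^ 2) * n := Nat.mul_le_mul (by nlinarith) h2
      _ ≤ _ := hlen ▸ h1
  · have hrun : ∀ (π : I) (z z' : List (CactusLetter Q α)), z ++ z' = p ++ x ++ y ++ q →
        A.IsRunSeamless (w₁ ++ z ++ z') π.1 := fun π z z' hz => by
      rw [List.append_assoc, hz]; exact h.independent.1 π.1 π.2
    -- twice the right-hand side is at least `Cov(d + 1, i - 1)` as the runs are separated, and by the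
    -- recursion for `Cov` and `|S| ≤ 𝔪` this is more than twice the left-hand side
    have hdist : ∀ π π' : I, π ≠ π' →
        2 * (A.simpCov (d + 1) i : ℤ) + 2 * (n * A.simpParams.maxW d : ℕ) +
          (4 * Fintype.card (AugState Q) * AugState.stabConst Q * A.wordEff (x ++ y) : ℕ) <
        |A.runVal (w₁ ++ p) π - A.runVal (w₁ ++ p) π'| := by
      intro π π' hne
      have hgap := h.independent.2 π.1 π.2 π'.1 π'.2 (fun h => hne (Subtype.ext h)) p
        (x ++ (y ++ q)) (by simp) _ _
        (hrun π p (x ++ (y ++ q)) (by simp)).runWt_eq (hrun π' p (x ++ (y ++ q)) (by simp)).runWt_eq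
      have h2 : 1 < i := by
        rw [← h.card_eq, Finset.one_lt_card]
        exact ⟨π.1, π.2, π'.1, π'.2, fun h => hne (Subtype.ext h)⟩
      obtain ⟨i, rfl⟩ : ∃ i', i = i' + 1 := ⟨i - 1, by omega⟩
      have hc := A.simpParams.cov_succ (d := d) (i := i) (by change i < Fintype.card _; omega)
      rw [Nat.add_sub_cancel] at hgap
      have hcp : 0 < A.simpCov (d + 1) (i + 1) := A.simpParams.cov_pos hm _ _
      have hL : 0 < A.simpLen d 1 := A.simpParams.len_pos hm _ _
      have hN := AugState.card_le_stabConst (Q := Q)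
      have hc' : A.simpCov (d + 1) i = 8 * AugState.stabConst Q ^ 2 *
          (A.simpParams.maxW d * A.simpLen d 1 * (32 * AugState.stabConst Q ^ 2 * n) +
            A.simpCov (d + 1) (i + 1)) := by rw [hlen]; exact hc
      generalize A.simpCov (d + 1) (i + 1) = C at *
      generalize AugState.stabConst Q = m at *
      generalize A.simpLen d 1 = L at *
      have hkey : 2 * (2 * C + 2 * (n * A.simpParams.maxW d) +
          4 * Fintype.card (AugState Q) * m * A.wordEff (x ++ y)) < A.simpCov (d + 1) i := by
        generalize A.simpParams.maxW d = W at *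
        generalize A.wordEff (x ++ y) = E at *
        generalize Fintype.card (AugState Q) = N at *
        have e1 : 4 * N * m * E ≤ 4 * m * m * (n * W) := by gcongr
        have e2 : n * W ≤ m * m * (n * W) := Nat.le_mul_of_pos_left _ (by positivity)
        have e3 : C ≤ m * m * C := Nat.le_mul_of_pos_left _ (by positivity)
        have e4 : m * m * (n * W) ≤ m * m * (n * W) * (m * m * L) :=
          Nat.le_mul_of_pos_right _ (by positivity)
        calc _ ≤ 4 * (m * m * C) + 4 * (m * m * (n * W)) + 8 * (m * m * (n * W)) := by linarith
          _ < 8 * (m * m * C) + 256 * (m * m * (n * W) * (m * m * L)) := by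
            have : 0 < m * m * C := by positivity
            linarith
          _ = _ := by rw [hc']; ring
      zify at hkey
      push_cast
      linarith
    obtain ⟨l, V, h1, h2, h3, h4, h5⟩ := exists_cluster_partition (ι := I) (A.simpCov (d + 1) i)
      (n * A.simpParams.maxW d)
      (4 * Fintype.card (AugState Q) * AugState.stabConst Q * A.wordEff (x ++ y))
      ![A.conf (w₁ ++ p), A.conf (w₁ ++ (p ++ x)), A.conf (w₁ ++ (p ++ x ++ y))]
      ![fun π => A.runVal (w₁ ++ p) π, fun π => A.runVal (w₁ ++ (p ++ x)) π,
        fun π => A.runVal (w₁ ++ (p ++ x ++ y)) π]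
      (fun π => ⟨_, (hrun π p (x ++ (y ++ q)) (by simp)).conf_eq⟩)
      (fun s hs => by
        obtain ⟨π, hπ, hne⟩ := hcov p (by simp) s hs
        exact ⟨⟨π, hπ⟩, hne⟩)
      (fun k s π => by
        fin_cases k
        · rfl
        · exact htype (p ++ x) (by simp) s π.1 π.2
        · exact htype (p ++ x ++ y) (by simp) s π.1 π.2)
      (fun k π => by
        fin_cases k
        · simp; positivity
        · refine (IsRunSeamless.abs_runVal_sub_le (w := w₁ ++ p) (x := x) (y := y ++ q)
            (by simpa using hrun π p (x ++ (y ++ q)) (by simp))).trans' ?_ |>.trans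
              (by exact_mod_cast hx')
          simp
        · refine (IsRunSeamless.abs_runVal_sub_le (w := w₁ ++ p) (x := x ++ y) (y := q)
            (by simpa using hrun π p (x ++ (y ++ q)) (by simp))).trans' ?_ |>.trans
              (by exact_mod_cast hxy)
          simp)
      hdist
      (fun π => hsign π.1 π.2)
    refine ⟨l, V, h1, h2, h3, fun j j' hjj s hs s' hs' ξ hξ => ?_, fun j => ?_⟩
    · simp only [List.mem_cons, List.not_mem_nil, or_false] at hξ
      rcases hξ with rfl | rfl | rfl
      · exact h4 j j' hjj s hs s' hs' 0
      · simpa using h4 j j' hjj s hs s' hs' 1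
      · simpa using h4 j j' hjj s hs s' hs' 2
    · simpa using h5 j
  · have := h.increasing.1
    simpa using this
  · simpa using hpx
  · simpa using hpy
  · simpa using hpi

end WFA

/-! ### States far away from the given runs -/

namespace WFA

open LetterTrans CactusLetter

variable {Q : Type u} {α : Type v} [Fintype Q] [DecidableEq Q]

theorem isHalfIndependent_iff (A : WFA Q α) {w₁ w₂ : List (CactusLetter Q α)} {G : ℕ}
    {I : Finset (List (AugState Q))} :
    A.IsHalfIndependent w₁ w₂ G I ↔ (∀ π ∈ I, A.IsRunSeamless (w₁ ++ w₂) π) ∧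
      ∀ π ∈ I, ∀ π' ∈ I, π ≠ π' → ∀ x y, w₂ = x ++ y →
        (G : ℤ) ≤ 2 * |A.runVal (w₁ ++ x) π - A.runVal (w₁ ++ x) π'| := by
  refine and_congr_right fun hs => ?_
  refine forall₂_congr fun π hπ => forall₂_congr fun π' hπ' => forall_congr' fun _ =>
    forall₂_congr fun x y => forall_congr' fun hxy => ?_
  have h1 := hs π hπ
  have h2 := hs π' hπ'
  rw [hxy, ← List.append_assoc] at h1 h2
  rw [h1.runWt_eq, h2.runWt_eq]
  constructor
  · intro h
    exact h _ _ rfl rfl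
  · intro h k k' hk hk'
    rwa [← WithTop.coe_inj.1 hk, ← WithTop.coe_inj.1 hk']

theorem lt_abs_sub_of_clampDiff_eq_none {C : ℕ} {k r : ℤ} (h : clampDiff C k r = none) :
    (C : ℤ) < |k - r| := by
  by_contra hcon
  have h1 := abs_le.1 (not_lt.1 hcon)
  have : clampDiff C k r = some ⟨k - r, Finset.mem_Icc.2 h1⟩ :=
    clampDiff_eq_some_iff.2 (by simp)
  rw [h] at this
  simp at this

variable [Fintype α]

theorem simpCov_succ_le (A : WFA Q α) {d i : ℕ} (hi : i < Fintype.card (AugState Q)) :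
    A.simpCov (d + 1) (i + 1) ≤ A.simpCov (d + 1) i := by
  have hm := A.stabConst_pos
  have h : A.simpCov (d + 1) i = _ := A.simpParams.cov_succ (d := d) hi
  rw [h]
  refine le_trans ?_ (Nat.le_mul_of_pos_left _ (Nat.mul_pos (by norm_num) (pow_pos hm 2)))
  change A.simpParams.cov _ _ ≤ _
  omega

/-- Distinct runs of a well-separated word have distinct weights. -/
theorem IsWellSeparated.runVal_ne {A : WFA Q α} {d i : ℕ}
    {w₁ w₂ w₃ p q : List (CactusLetter Q α)} {I : Finset (List (AugState Q))}
    (h : A.IsWellSeparated d i w₁ w₂ w₃ I) (hpq : w₂ = p ++ q)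
    {π π' : List (AugState Q)} (hπ : π ∈ I) (hπ' : π' ∈ I) (hne : π ≠ π') :
    A.runVal (w₁ ++ p) π ≠ A.runVal (w₁ ++ p) π' := by
  intro heq
  have h1 := (A.isHalfIndependent_iff.1 h.independent).2 π hπ π' hπ' hne p q hpq
  have h2 : 0 < A.simpCov (d + 1) (i - 1) := A.simpParams.cov_pos A.stabConst_pos _ _
  rw [heq, sub_self, abs_zero] at h1
  omega

/-- With as many runs as there are states, every state is the current state of one of the runs. -/
theorem IsWellSeparated.exists_clampDiff_ne_none {A : WFA Q α} {d : ℕ}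
    {w₁ w₂ w₃ p q : List (CactusLetter Q α)} {I : Finset (List (AugState Q))}
    (h : A.IsWellSeparated d (Fintype.card (AugState Q)) w₁ w₂ w₃ I) (hpq : w₂ = p ++ q)
    (C : ℕ) (s : AugState Q) :
    ∃ π ∈ I, clampDiff C (A.conf (w₁ ++ p) s) (A.runVal (w₁ ++ p) π) ≠ none := by
  have hconf : ∀ π ∈ I, A.conf (w₁ ++ p) (endState A.augInit (π.take (w₁ ++ p).length)) =
      A.runVal (w₁ ++ p) π := fun π hπ => by
    have := h.independent.1 π hπ
    rw [hpq, ← List.append_assoc] at this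
    exact this.conf_eq
  have hinj : Set.InjOn (fun π : List (AugState Q) => endState A.augInit (π.take (w₁ ++ p).length))
      (I : Set (List (AugState Q))) := by
    intro π hπ π' hπ' heq
    by_contra hne
    refine h.runVal_ne hpq hπ hπ' hne ?_
    have h1 := hconf π hπ
    simp only at heq
    rw [heq, hconf π' hπ', WithTop.coe_inj] at h1
    exact h1.symm
  have himg := Finset.eq_univ_of_card _ ((Finset.card_image_of_injOn hinj).trans h.card_eq)
  obtain ⟨π, hπ, rfl⟩ := Finset.mem_image.1 (himg ▸ Finset.mem_univ s)
  refine ⟨π, hπ, ?_⟩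
  have : clampDiff C (A.conf (w₁ ++ p) (endState A.augInit (π.take (w₁ ++ p).length)))
      (A.runVal (w₁ ++ p) π) = some ⟨0, by simp⟩ :=
    clampDiff_eq_some_iff.2 (by rw [hconf π hπ, add_zero])
  rw [this]
  exact Option.some_ne_none _

/-- A state far from all runs after `p z` yields a further run. Since weights change slowly, it has
been far from the others all along `z`. -/
theorem IsWellSeparated.exists_succ {A : WFA Q α} {d i : ℕ}
    {w₁ p z q w₃ : List (CactusLetter Q α)} {I : Finset (List (AugState Q))}
    (h : A.IsWellSeparated d i w₁ (p ++ z ++ q) w₃ I) (hi1 : 1 ≤ i)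
    (hi : i < Fintype.card (AugState Q))
    (hz : 32 * AugState.stabConst Q ^ 2 * z.length = A.simpLen (d + 1) (i + 1))
    (hpot : A.potential (w₁ ++ p) ≤ A.potential (w₁ ++ (p ++ z)))
    {s : AugState Q} (hs : A.conf (w₁ ++ (p ++ z)) s ≠ ⊤)
    (hfar : ∀ π ∈ I, clampDiff (A.simpCov (d + 1) i) (A.conf (w₁ ++ (p ++ z)) s)
      (A.runVal (w₁ ++ (p ++ z)) π) = none) :
    ∃ I', A.IsWellSeparated d (i + 1) (w₁ ++ p) z (q ++ w₃) I' := by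
  have hm := A.stabConst_pos
  obtain ⟨π₀, hπ₀, hval⟩ := exists_isRunSeamless hs
  rw [← List.append_assoc] at hπ₀
  have hI := A.isHalfIndependent_iff.1 h.independent
  set n := (w₁ ++ (p ++ z)).length with hn
  have hseam : ∀ π ∈ I, A.IsRunSeamless (w₁ ++ p ++ z) (π.take n) := fun π hπ => by
    have h1 := hI.1 π hπ
    rw [← List.append_assoc] at h1
    have h2 := h1.of_append
    rw [← hn, ← List.append_assoc] at h2
    exact h2
  have hfar' : ∀ π ∈ I, (A.simpCov (d + 1) i : ℤ) <
      |A.runVal (w₁ ++ (p ++ z)) π₀ - A.runVal (w₁ ++ (p ++ z)) π| := fun π hπ =>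
    lt_abs_sub_of_clampDiff_eq_none (hval ▸ hfar π hπ)
  have htake : ∀ π x y, z = x ++ y →
      A.runVal (w₁ ++ p ++ x) (π.take n) = A.runVal (w₁ ++ p ++ x) π := fun π x y hxy =>
    runVal_take (by simp [hn, hxy])
  have hdepz : wordDepth z ≤ d := wordDepth_le fun a ha =>
    (depth_le_wordDepth (by simp [ha])).trans h.depth_le
  have hcov : 4 * (z.length * A.simpParams.maxW d) ≤ A.simpCov (d + 1) i := by
    have hc : A.simpCov (d + 1) i = 8 * AugState.stabConst Q ^ 2 *
        (A.simpParams.maxW d * A.simpLen d 1 * A.simpLen (d + 1) (i + 1) +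
          A.simpCov (d + 1) (i + 1) + 0) := A.simpParams.cov_succ (d := d) hi
    have hL : 0 < A.simpLen d 1 := A.simpParams.len_pos hm _ _
    rw [hc, ← hz]
    generalize AugState.stabConst Q = m at *
    calc 4 * (z.length * A.simpParams.maxW d)
        ≤ 4 * (z.length * A.simpParams.maxW d) * (64 * m ^ 4 * A.simpLen d 1) :=
          Nat.le_mul_of_pos_right _ (by positivity)
      _ ≤ 4 * (z.length * A.simpParams.maxW d) * (64 * m ^ 4 * A.simpLen d 1) +
          8 * m ^ 2 * A.simpCov (d + 1) (i + 1) := Nat.le_add_right _ _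
      _ = _ := by ring
  have hnew : ∀ π ∈ I, ∀ x y, z = x ++ y → (A.simpCov (d + 1) i : ℤ) ≤
      2 * |A.runVal (w₁ ++ p ++ x) π₀ - A.runVal (w₁ ++ p ++ x) π| := by
    intro π hπ x y hxy
    subst hxy
    have h1 := IsRunSeamless.abs_runVal_sub_le (w := w₁ ++ p ++ x) (x := y) (y := q)
      (by simpa using hI.1 π hπ)
    have h2 := IsRunSeamless.abs_runVal_sub_le (w := w₁ ++ p ++ x) (x := y) (y := [])
      (by simpa using hπ₀)
    have h3 := hfar' π hπ
    have h4 : A.wordEff y ≤ (x ++ y).length * A.simpParams.maxW d :=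
      (A.wordEff_le_maxW (fun a ha => h.mem_alph a (by simp [ha]))
        (wordDepth_le fun a ha => (depth_le_wordDepth (List.mem_append_right x ha)).trans
          hdepz)).trans (Nat.mul_le_mul_right _ (by simp))
    have h5 : w₁ ++ p ++ x ++ y = w₁ ++ (p ++ (x ++ y)) := by simp
    rw [h5] at h1 h2
    have h6 := abs_sub_abs_le_abs_sub
      (A.runVal (w₁ ++ (p ++ (x ++ y))) π₀ - A.runVal (w₁ ++ (p ++ (x ++ y))) π)
      (A.runVal (w₁ ++ p ++ x) π₀ - A.runVal (w₁ ++ p ++ x) π)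
    rw [show A.runVal (w₁ ++ (p ++ (x ++ y))) π₀ - A.runVal (w₁ ++ (p ++ (x ++ y))) π -
      (A.runVal (w₁ ++ p ++ x) π₀ - A.runVal (w₁ ++ p ++ x) π) =
      (A.runVal (w₁ ++ (p ++ (x ++ y))) π₀ - A.runVal (w₁ ++ p ++ x) π₀) -
      (A.runVal (w₁ ++ (p ++ (x ++ y))) π - A.runVal (w₁ ++ p ++ x) π) by ring] at h6
    have h7 := h6.trans (abs_sub _ _)
    omega
  have hold : ∀ π ∈ I, ∀ π' ∈ I, π ≠ π' → ∀ x y, z = x ++ y → (A.simpCov (d + 1) i : ℤ) ≤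
      2 * |A.runVal (w₁ ++ p ++ x) π - A.runVal (w₁ ++ p ++ x) π'| := by
    intro π hπ π' hπ' hne x y hxy
    have h1 := hI.2 π hπ π' hπ' hne (p ++ x) (y ++ q) (by simp [hxy])
    obtain ⟨i, rfl⟩ : ∃ i', i = i' + 1 := ⟨i - 1, by omega⟩
    have h2 := A.simpCov_succ_le (d := d) (i := i) (by omega)
    rw [Nat.add_sub_cancel, ← List.append_assoc] at h1
    omega
  have hnot : π₀ ∉ I.image (List.take n) := by
    intro hmem
    obtain ⟨π, hπ, rfl⟩ := Finset.mem_image.1 hmem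
    have h1 := hfar' π hπ
    rw [runVal_take le_rfl, sub_self, abs_zero] at h1
    omega
  have hinj : Set.InjOn (List.take n) (I : Set (List (AugState Q))) := by
    intro π hπ π' hπ' heq
    by_contra hne
    have h1 := h.runVal_ne (p := p ++ z) (q := q) rfl hπ hπ' hne
    rw [← runVal_take (n := n) le_rfl, heq, runVal_take le_rfl] at h1
    exact h1 rfl
  have hall : ∀ a ∈ w₁ ++ p ++ z ++ (q ++ w₃), a ∈ A.simpAlph := by
    simpa [or_assoc] using h.mem_alph
  refine ⟨insert π₀ (I.image (List.take n)), hall, ⟨by simpa using h.increasing.1, ?_⟩,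
    hdepz, hz.le, ?_, A.isHalfIndependent_iff.2 ⟨fun π hπ => ?_, ?_⟩⟩
  · simpa using hpot
  · rw [Finset.card_insert_of_notMem hnot, Finset.card_image_of_injOn hinj, h.card_eq]
  · rcases Finset.mem_insert.1 hπ with rfl | hmem
    · exact hπ₀
    · obtain ⟨σ, hσ, rfl⟩ := Finset.mem_image.1 hmem
      exact hseam σ hσ
  · intro π hπ π' hπ' hne x y hxy
    rw [Nat.add_sub_cancel]
    rcases Finset.mem_insert.1 hπ with h1 | h1 <;> rcases Finset.mem_insert.1 hπ' with h2 | h2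
    · exact absurd (h1.trans h2.symm) hne
    · obtain ⟨σ', hσ', rfl⟩ := Finset.mem_image.1 h2
      rw [h1, htake σ' x y hxy]
      exact hnew σ' hσ' x y hxy
    · obtain ⟨σ, hσ, rfl⟩ := Finset.mem_image.1 h1
      rw [h2, htake σ x y hxy, abs_sub_comm]
      exact hnew σ hσ x y hxy
    · obtain ⟨σ, hσ, rfl⟩ := Finset.mem_image.1 h1
      obtain ⟨σ', hσ', rfl⟩ := Finset.mem_image.1 h2
      rw [htake σ x y hxy, htake σ' x y hxy]
      exact hold σ hσ σ' hσ' (fun h => hne (h ▸ rfl)) x y hxy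

end WFA

/-! ### Induction on the number of runs -/

namespace WFA

open LetterTrans CactusLetter

variable {Q : Type u} {α : Type v} [Fintype Q] [DecidableEq Q] [Fintype α]

/-- A single run, for which the baseline run is taken, is separated for trivial reasons. -/
theorem IsPotentialIncreasing.isWellSeparated_one {A : WFA Q α} {d : ℕ}
    {w₁ w₂ w₃ : List (CactusLetter Q α)} (h : A.IsPotentialIncreasing w₁ w₂ w₃)
    (hmem : ∀ a ∈ w₁ ++ w₂ ++ w₃, a ∈ A.simpAlph) (hdep : wordDepth w₂ ≤ d)
    (hlen : 32 * AugState.stabConst Q ^ 2 * w₂.length ≤ A.simpLen (d + 1) 1) :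
    ∃ I, A.IsWellSeparated d 1 w₁ w₂ w₃ I := by
  obtain ⟨π, hπ, -⟩ := h.1
  refine ⟨{π.take (w₁ ++ w₂).length}, hmem, h, hdep, hlen, by simp,
    A.isHalfIndependent_iff.2 ⟨fun σ hσ => ?_, fun σ hσ σ' hσ' hne => ?_⟩⟩
  · rw [Finset.mem_singleton.1 hσ]
    exact hπ.of_append
  · exact absurd ((Finset.mem_singleton.1 hσ).trans (Finset.mem_singleton.1 hσ').symm) hne

/-- Some infix of `w₂` is either a simple separated repeating infix `xy` with `x` of depth `d`, or the
middle part of a `(d - 1, 1)`-fit and well separated word of the full length. -/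
def HasSeparatedPart (A : WFA Q α) (d : ℕ) (w₁ w₂ w₃ : List (CactusLetter Q α)) : Prop :=
  (∃ p x y q : List (CactusLetter Q α), w₂ = p ++ x ++ y ++ q ∧
    CactusLetter.wordDepth x = d ∧ A.IsSSRI (w₁ ++ p) x y (q ++ w₃)) ∨
  (∃ (d' : ℕ) (p w₂' q : List (CactusLetter Q α)) (I' : Finset (List (AugState Q))),
    d = d' + 1 ∧ w₂ = p ++ w₂' ++ q ∧
    A.IsWellSeparated d' 1 (w₁ ++ p) w₂' (q ++ w₃) I' ∧
    32 * AugState.stabConst Q ^ 2 * w₂'.length = A.simpLen d 1)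

theorem HasSeparatedPart.extend {A : WFA Q α} {d : ℕ} {w₁ p z q w₃ : List (CactusLetter Q α)}
    (h : A.HasSeparatedPart d (w₁ ++ p) z (q ++ w₃)) :
    A.HasSeparatedPart d w₁ (p ++ z ++ q) w₃ := by
  rcases h with ⟨p', x, y, q', rfl, h1, h2⟩ | ⟨d', p', w, q', I', h1, rfl, h2, h3⟩
  · exact Or.inl ⟨p ++ p', x, y, q' ++ q, by simp, h1, by simpa using h2⟩
  · exact Or.inr ⟨d', p ++ p', w, q' ++ q, I', h1, by simp, by simpa using h2, h3⟩

theorem _root_.List.take_append_drop_take {β : Type*} (l : List β) {s t : ℕ} (h : s ≤ t) :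
    l.take s ++ (l.take t).drop s = l.take t := by
  have := List.take_append_drop s (l.take t)
  rwa [List.take_take, min_eq_left h] at this

/-- The induction step. If neither alternative holds, windows of the two lengths occurring in the
recursion behave well, so that times of high potential can be compared by Ramsey's theorem. -/
theorem hasSeparatedPart_of_succ (A : WFA Q α) {d i : ℕ}
    {w₁ w₂ w₃ : List (CactusLetter Q α)} {I : Finset (List (AugState Q))}
    (hi1 : 1 ≤ i) (hi : i ≤ Fintype.card (AugState Q))
    (h : A.IsWellSeparated d i w₁ w₂ w₃ I)
    (hlen : 32 * AugState.stabConst Q ^ 2 * w₂.length = A.simpLen (d + 1) i)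
    (ih : i < Fintype.card (AugState Q) → ∀ (w₁ w₂ w₃ : List (CactusLetter Q α))
      (I : Finset (List (AugState Q))), A.IsWellSeparated d (i + 1) w₁ w₂ w₃ I →
      32 * AugState.stabConst Q ^ 2 * w₂.length = A.simpLen (d + 1) (i + 1) →
      A.HasSeparatedPart d w₁ w₂ w₃) :
    A.HasSeparatedPart d w₁ w₂ w₃ := by
  classical
  by_contra hno
  have hm := A.stabConst_pos
  set W := A.simpParams.maxW d with hW
  set φ : ℕ → ℤ := fun t => A.potential (w₁ ++ w₂.take t) with hφ
  set seg : ℕ → ℕ → List (CactusLetter Q α) := fun s t => (w₂.take t).drop s with hseg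
  have hcat : ∀ s t, s ≤ t → w₂.take s ++ seg s t = w₂.take t := fun s t hst =>
    w₂.take_append_drop_take hst
  have hfull : ∀ s t, s ≤ t → w₂ = w₂.take s ++ seg s t ++ w₂.drop t := fun s t hst => by
    rw [hcat s t hst, List.take_append_drop]
  have hmemseg : ∀ s t, ∀ a ∈ seg s t, a ∈ w₂ := fun s t a ha =>
    List.mem_of_mem_take (List.mem_of_mem_drop ha)
  have halph : ∀ a ∈ w₂, a ∈ A.simpAlph := fun a ha => h.mem_alph a (by simp [ha])
  have hlenseg : ∀ s t, t ≤ w₂.length → (seg s t).length = t - s := fun s t ht => by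
    simp [hseg, ht]
  have hdepseg : ∀ s t, wordDepth (seg s t) ≤ d := fun s t => wordDepth_le fun a ha =>
    (depth_le_wordDepth (hmemseg s t a ha)).trans h.depth_le
  have hgrow : ∀ s t, s ≤ t → φ t ≤ φ s + A.wordEff (seg s t) := by
    intro s t hst
    have h1 := A.potential_append_le (w := w₁ ++ w₂.take s) (x := seg s t)
      (fun a ha => halph a (hmemseg s t a ha)) (by
        obtain ⟨π, hπ, -⟩ := h.increasing.1
        refine IsRunSeamless.exists_conf_ne_top (x := w₂.drop t ++ w₃) (π := π) ?_
        rw [List.append_assoc w₁, hcat s t hst, ← List.append_assoc, List.append_assoc w₁,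
          List.take_append_drop]
        exact hπ)
    rwa [List.append_assoc, hcat s t hst] at h1
  -- windows on which the potential does not drop have full depth
  obtain ⟨lam, hlam, hlam32⟩ : ∃ lam : ℕ,
      (1 ≤ d → 32 * AugState.stabConst Q ^ 2 * lam = A.simpLen d 1) ∧
      32 * lam ≤ A.simpLen d 1 := by
    cases d with
    | zero => exact ⟨0, by simp, by simp⟩
    | succ d =>
      refine ⟨_, fun _ => (A.simpParams.len_succ (i := 1) (d := d) (hi1.trans hi)).symm, ?_⟩
      have h1 : A.simpLen (d + 1) 1 = _ := A.simpParams.len_succ (i := 1) (d := d) (hi1.trans hi)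
      rw [h1]
      exact Nat.mul_le_mul_right _ (Nat.le_mul_of_pos_right _ (pow_pos hm 2))
  have hdeep : ∀ s t, s ≤ t → t ≤ w₂.length → t - s = lam → φ s ≤ φ t →
      wordDepth (seg s t) = d := by
    intro s t hst ht hlen' hst'
    by_contra hne
    have hlt := lt_of_le_of_ne (hdepseg s t) hne
    obtain ⟨d', rfl⟩ : ∃ d', d = d' + 1 := ⟨d - 1, by omega⟩
    have hl : 32 * AugState.stabConst Q ^ 2 * (seg s t).length = A.simpLen (d' + 1) 1 := by
      rw [hlenseg s t ht, hlen', hlam (by omega)]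
    obtain ⟨I', hI'⟩ := IsPotentialIncreasing.isWellSeparated_one (A := A) (d := d')
      (w₁ := w₁ ++ w₂.take s) (w₂ := seg s t) (w₃ := w₂.drop t ++ w₃)
      ⟨by
        have := h.increasing.1
        rw [hfull s t hst] at this
        simpa using this, by
        rw [List.append_assoc, hcat s t hst]
        exact hst'⟩ (by
        have := h.mem_alph
        rw [hfull s t hst] at this
        simpa [or_assoc] using this) (by omega) hl.le
    exact hno (Or.inr ⟨d', _, _, _, I', rfl, hfull s t hst, hI', hl⟩)
  -- after windows on which the potential does not drop, all states are near the runs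
  obtain ⟨ell, hell, hell32⟩ : ∃ ell : ℕ,
      (i < Fintype.card (AugState Q) →
        32 * AugState.stabConst Q ^ 2 * ell = A.simpLen (d + 1) (i + 1)) ∧
      32 * ell ≤ A.simpLen (d + 1) (i + 1) := by
    by_cases hiN : i < Fintype.card (AugState Q)
    · have h1 : A.simpLen (d + 1) (i + 1) = _ := A.simpParams.len_succ (i := i + 1) (d := d) hiN
      refine ⟨_, fun _ => h1.symm, ?_⟩
      rw [h1]
      exact Nat.mul_le_mul_right _ (Nat.le_mul_of_pos_right _ (pow_pos hm 2))
    · exact ⟨0, fun h => absurd h hiN, by simp⟩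
  have hnear : ∀ s t, s ≤ t → t ≤ w₂.length → t - s = ell → φ s ≤ φ t → ∀ r,
      A.conf (w₁ ++ w₂.take t) r ≠ ⊤ → ∃ π ∈ I, clampDiff (A.simpCov (d + 1) i)
        (A.conf (w₁ ++ w₂.take t) r) (A.runVal (w₁ ++ w₂.take t) π) ≠ none := by
    intro s t hst ht hlen' hst' r hr
    rcases eq_or_lt_of_le hi with rfl | hiN
    · exact h.exists_clampDiff_ne_none (List.take_append_drop t w₂).symm _ r
    · by_contra hcon
      push Not at hcon
      have hl : 32 * AugState.stabConst Q ^ 2 * (seg s t).length =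
          A.simpLen (d + 1) (i + 1) := by
        rw [hlenseg s t ht, hlen', hell hiN]
      obtain ⟨I', hI'⟩ := IsWellSeparated.exists_succ (A := A) (d := d) (i := i) (I := I)
        (w₁ := w₁) (p := w₂.take s) (z := seg s t) (q := w₂.drop t) (w₃ := w₃) (s := r)
        (by rw [← hfull s t hst]; exact h) hi1 hiN hl (by rw [hcat s t hst]; exact hst')
        (by rw [hcat s t hst]; exact hr) (by rw [hcat s t hst]; exact hcon)
      have h1 := (ih hiN _ _ _ _ hI' hl).extend
      rw [← hfull s t hst] at h1
      exact hno h1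
  -- times at which the potential is high
  have hL0 : 0 < A.simpLen d 1 := A.simpParams.len_pos hm _ _
  have hL1 : 0 < A.simpLen (d + 1) (i + 1) := A.simpParams.len_pos hm _ _
  obtain ⟨f, hf, hfmono, hfφ⟩ := exists_record_times φ
    (ramseyNumber (A.simpParams.typ (d + 1) i) 3) (ell + lam + 1)
    (A.simpLen d 1 * A.simpLen (d + 1) (i + 1)) W (A.simpParams.amp (d + 1) i) w₂.length
    (fun r hr => by
      refine (hgrow r (r + 1) (Nat.le_succ r)).trans ?_
      have h1 := A.wordEff_le_maxW (fun a ha => halph a (hmemseg r (r + 1) a ha))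
        (hdepseg r (r + 1))
      rw [hlenseg r (r + 1) hr, Nat.add_sub_cancel_left, one_mul] at h1
      have : (A.wordEff (seg r (r + 1)) : ℤ) ≤ W := by exact_mod_cast h1
      linarith)
    (by simpa [hφ] using h.increasing.2) (A.length_eq_of_simpLen hi hlen) (by omega)
    (by
      -- `ell + lam + 1` is at most the product since `32 * ell` and `32 * lam` are at most its factors
      rcases Nat.eq_zero_or_pos (ell + lam) with h0 | h0
      · rw [h0]
        have := Nat.mul_pos hL0 hL1
        omega
      · obtain ⟨x, hx⟩ : ∃ x, A.simpLen d 1 = x + 1 := ⟨_, (Nat.sub_add_cancel hL0).symm⟩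
        obtain ⟨y, hy⟩ : ∃ y, A.simpLen (d + 1) (i + 1) = y + 1 :=
          ⟨_, (Nat.sub_add_cancel hL1).symm⟩
        rw [hx] at hlam32 ⊢
        rw [hy] at hell32 ⊢
        have : (x + 1) * (y + 1) = x * y + x + y + 1 := by ring
        have := Nat.zero_le (x * y)
        omega)
    (by
      have h1 : A.simpParams.amp (d + 1) i = 32 * AugState.stabConst Q ^ 2 * (0 + 2 * W) *
        (ramseyNumber (A.simpParams.typ (d + 1) i) 3 + A.simpLen (d + 1) (i + 1) +
          A.simpLen d 1) := A.simpParams.amp_succ (d := d) hi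
      rw [h1]
      generalize ramseyNumber (A.simpParams.typ (d + 1) i) 3 = R at *
      calc W * (ell + lam + 1) + 2 * W * R
          ≤ 2 * W * (R + A.simpLen (d + 1) (i + 1) + A.simpLen d 1) := by
            have : ell + lam + 1 ≤ A.simpLen (d + 1) (i + 1) + A.simpLen d 1 := by omega
            have := Nat.mul_le_mul_left W this
            nlinarith
        _ ≤ 2 * W * (R + A.simpLen (d + 1) (i + 1) + A.simpLen d 1) *
            (32 * AugState.stabConst Q ^ 2) := Nat.le_mul_of_pos_right _ (by positivity)
        _ = _ := by ring)
  -- a letter of depth `d` is read between any two of them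
  have hdeep' : ∀ j j', j < j' → j' < ramseyNumber (A.simpParams.typ (d + 1) i) 3 →
      wordDepth (seg (f j) (f j')) = d := by
    intro j j' hjj hj'
    obtain ⟨hb, hn, hrec⟩ := hf j' hj'
    have hlt := hfmono j j' hjj hj'
    by_cases hgap : f j + lam ≤ f j'
    · have h1 := hdeep (f j' - lam) (f j') (by omega) hn (by omega) (hrec lam (by omega))
      refine le_antisymm (hdepseg _ _) (h1 ▸ wordDepth_le fun a ha => depth_le_wordDepth ?_)
      have h2 : seg (f j' - lam) (f j') = (seg (f j) (f j')).drop (f j' - lam - f j) := by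
        simp only [hseg, List.drop_drop]
        congr 1
        omega
      rw [h2] at ha
      exact List.mem_of_mem_drop ha
    · have hrise : φ (f j) + W < φ (f j') := by
        rcases hfφ with h1 | h1
        · have := (h1 j j' hjj hj').2
          omega
        · exact h1 j j' hjj hj'
      by_contra hne
      -- letters of smaller depth have too little effect for such a rise
      have hlt' := lt_of_le_of_ne (hdepseg (f j) (f j')) hne
      obtain ⟨d', rfl⟩ : ∃ d', d = d' + 1 := ⟨d - 1, by omega⟩
      have h1 := hgrow (f j) (f j') hlt.le
      have h2 := A.wordEff_le_maxW (d := d') (fun a ha => halph a (hmemseg (f j) (f j') a ha))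
        (by omega)
      have h3 : (seg (f j) (f j')).length ≤ A.simpLen (d' + 1) 1 := by
        rw [hlenseg _ _ hn]; omega
      have h4 : A.wordEff (seg (f j) (f j')) ≤ W := by
        have hW' : W = 2 * AugState.stabConst Q * A.simpParams.maxW d' * A.simpLen (d' + 1) 1 :=
          A.simpParams.maxW_succ d'
        rw [hW']
        calc _ ≤ A.simpLen (d' + 1) 1 * A.simpParams.maxW d' :=
              h2.trans (Nat.mul_le_mul_right _ h3)
          _ ≤ A.simpLen (d' + 1) 1 * A.simpParams.maxW d' * (2 * AugState.stabConst Q) :=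
              Nat.le_mul_of_pos_right _ (by positivity)
          _ = _ := by ring
      omega
  -- three of them between which nothing changes as seen from the runs
  obtain ⟨j₁, j₂, j₃, h12, h23, h3, hsign, htype⟩ := exists_similar_positions (ι := I)
    (A.simpCov (d + 1) i) (k := A.simpParams.typ (d + 1) i)
    (by rw [BoundParams.typ_eq, Fintype.card_coe, h.card_eq]; rfl)
    (fun j => A.conf (w₁ ++ w₂.take (f j))) (fun j π => A.runVal (w₁ ++ w₂.take (f j)) π)
  have hj1 := h12.trans (h23.trans h3)
  have hj2 := h23.trans h3
  have hf12 := hfmono j₁ j₂ h12 hj2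
  have hf23 := hfmono j₂ j₃ h23 h3
  have e2 : w₂.take (f j₁) ++ seg (f j₁) (f j₂) = w₂.take (f j₂) := hcat _ _ hf12.le
  have e3 : w₂.take (f j₁) ++ seg (f j₁) (f j₂) ++ seg (f j₂) (f j₃) = w₂.take (f j₃) := by
    rw [e2]; exact hcat _ _ hf23.le
  have e4 : w₂.take (f j₁) ++ seg (f j₁) (f j₂) ++ seg (f j₂) (f j₃) ++ w₂.drop (f j₃) = w₂ := by
    rw [e3]; exact List.take_append_drop _ _
  have hcovj : ∀ j < ramseyNumber (A.simpParams.typ (d + 1) i) 3, ∀ r,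
      A.conf (w₁ ++ w₂.take (f j)) r ≠ ⊤ → ∃ π ∈ I, clampDiff (A.simpCov (d + 1) i)
        (A.conf (w₁ ++ w₂.take (f j)) r) (A.runVal (w₁ ++ w₂.take (f j)) π) ≠ none := by
    intro j hj
    obtain ⟨hb, hn, hrec⟩ := hf j hj
    exact hnear (f j - ell) (f j) (by omega) hn (by omega) (hrec ell (by omega))
  have hpot : φ (f j₁) ≤ φ (f j₂) ∧ φ (f j₂) ≤ φ (f j₃) ∧
      (φ (f j₁) = φ (f j₂) ↔ φ (f j₂) = φ (f j₃)) := by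
    rcases hfφ with h1 | h1
    · have a1 := (h1 j₁ j₂ h12 hj2).1
      have a2 := (h1 j₂ j₃ h23 h3).1
      exact ⟨a1.le, a2.le, iff_of_true a1 a2⟩
    · have a1 := h1 j₁ j₂ h12 hj2
      have a2 := h1 j₂ j₃ h23 h3
      omega
  refine hno (Or.inl ⟨w₂.take (f j₁), seg (f j₁) (f j₂), seg (f j₂) (f j₃), w₂.drop (f j₃),
    e4.symm, hdeep' j₁ j₂ h12 hj2, ?_⟩)
  refine A.isSSRI_of_clampDiff_eq (I := I) hi1 hi (by rw [e4]; exact h) (by rw [e4]; exact hlen)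
    ?_ ?_ (hdeep' j₁ j₂ h12 hj2) ?_ ?_ ?_ ?_ ?_ ?_
  · have := hlenseg (f j₁) (f j₂) (hf j₂ hj2).2.1
    exact List.ne_nil_of_length_pos (by omega)
  · have := hlenseg (f j₂) (f j₃) (hf j₃ h3).2.1
    exact List.ne_nil_of_length_pos (by omega)
  · rw [e3, e2]
    intro z hz
    simp only [List.mem_cons, List.not_mem_nil, or_false] at hz
    rcases hz with rfl | rfl | rfl
    · exact hcovj _ hj1
    · exact hcovj _ hj2
    · exact hcovj _ h3
  · rw [e3, e2]
    intro z hz s π hπ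
    simp only [List.mem_cons, List.not_mem_nil, or_false] at hz
    rcases hz with rfl | rfl | rfl
    · rfl
    · exact (htype s ⟨π, hπ⟩).1
    · exact (htype s ⟨π, hπ⟩).2
  · rw [e3, e2]
    exact fun π hπ => hsign ⟨π, hπ⟩
  · rw [e2]; exact hpot.1
  · rw [e3, e2]; exact hpot.2.1
  · rw [e3, e2]; exact hpot.2.2

theorem IsWellSeparated.hasSeparatedPart {A : WFA Q α} {d i : ℕ}
    {w₁ w₂ w₃ : List (CactusLetter Q α)} {I : Finset (List (AugState Q))}
    (hi1 : 1 ≤ i) (hi : i ≤ Fintype.card (AugState Q))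
    (h : A.IsWellSeparated d i w₁ w₂ w₃ I)
    (hlen : 32 * AugState.stabConst Q ^ 2 * w₂.length = A.simpLen (d + 1) i) :
    A.HasSeparatedPart d w₁ w₂ w₃ := by
  obtain ⟨k, hk⟩ := Nat.exists_eq_add_of_le hi
  induction k generalizing i w₁ w₂ w₃ I with
  | zero => exact A.hasSeparatedPart_of_succ hi1 hi h hlen fun hlt => absurd hlt (by omega)
  | succ k ih =>
    exact A.hasSeparatedPart_of_succ hi1 hi h hlen fun hlt w₁ w₂ w₃ I h' hlen' =>
      ih (by omega) hlt h' hlen' (by omega)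

/-- The second alternative lowers the depth, so that the first one holds eventually. -/
theorem IsWellSeparated.exists_isSSRI {A : WFA Q α} {d : ℕ}
    {w₁ w₂ w₃ : List (CactusLetter Q α)} {I : Finset (List (AugState Q))}
    (h : A.IsWellSeparated d 1 w₁ w₂ w₃ I)
    (hlen : 32 * AugState.stabConst Q ^ 2 * w₂.length = A.simpLen (d + 1) 1) :
    ∃ p x y q : List (CactusLetter Q α), w₂ = p ++ x ++ y ++ q ∧
      A.IsSSRI (w₁ ++ p) x y (q ++ w₃) := by
  induction d generalizing w₁ w₂ w₃ I with
  | zero =>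
    rcases h.hasSeparatedPart le_rfl (Fintype.card_pos_iff.2 ⟨A.augInit⟩) hlen with
      ⟨p, x, y, q, h1, -, h2⟩ | ⟨d', -, -, -, -, h1, -⟩
    · exact ⟨p, x, y, q, h1, h2⟩
    · omega
  | succ d ih =>
    rcases h.hasSeparatedPart le_rfl (Fintype.card_pos_iff.2 ⟨A.augInit⟩) hlen with
      ⟨p, x, y, q, h1, -, h2⟩ | ⟨d', p, w, q, I', h1, rfl, h2, h3⟩
    · exact ⟨p, x, y, q, h1, h2⟩
    · obtain rfl : d = d' := by omega
      obtain ⟨p', x, y, q', rfl, h4⟩ := ih h2 h3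
      exact ⟨p ++ p', x, y, q' ++ q, by simp, by simpa using h4⟩

end WFA

/-! ### The two parts of the theorem -/

theorem mainTheorem9 {Q : Type u} {α : Type v} [Fintype Q] [DecidableEq Q] [Fintype α]
    (A : WFA Q α) :
    -- well-separated words
    (∀ (d i : ℕ) (w₁ w₂ w₃ : List (CactusLetter Q α)) (I : Finset (List (AugState Q))),
      1 ≤ i → i ≤ Fintype.card (AugState Q) →
      A.IsWellSeparated d i w₁ w₂ w₃ I →
      32 * AugState.stabConst Q ^ 2 * w₂.length = A.simpLen (d + 1) i →
      (∃ p x y q : List (CactusLetter Q α), w₂ = p ++ x ++ y ++ q ∧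
        CactusLetter.wordDepth x = d ∧ A.IsSSRI (w₁ ++ p) x y (q ++ w₃)) ∨
      (∃ (d' : ℕ) (p w₂' q : List (CactusLetter Q α)) (I' : Finset (List (AugState Q))),
        d = d' + 1 ∧ w₂ = p ++ w₂' ++ q ∧
        A.IsWellSeparated d' 1 (w₁ ++ p) w₂' (q ++ w₃) I' ∧
        32 * AugState.stabConst Q ^ 2 * w₂'.length = A.simpLen d 1)) ∧
    -- potential-increasing words
    (∀ w₁ w₂ w₃ : List (CactusLetter Q α),
      (∀ a ∈ w₁ ++ w₂ ++ w₃, a ∈ A.simpAlph) →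
      A.IsPotentialIncreasing w₁ w₂ w₃ →
      32 * AugState.stabConst Q ^ 2 * w₂.length =
        A.simpLen (Fintype.card (AugState Q)) 1 →
      ∃ p x y q : List (CactusLetter Q α), w₂ = p ++ x ++ y ++ q ∧
        A.IsSSRI (w₁ ++ p) x y (q ++ w₃)) := by
  refine ⟨fun d i w₁ w₂ w₃ I hi1 hi h hlen => h.hasSeparatedPart hi1 hi hlen,
    fun w₁ w₂ w₃ hmem hinc hlen => ?_⟩
  obtain ⟨d, hd⟩ : ∃ d, Fintype.card (AugState Q) = d + 1 :=
    ⟨_, (Nat.sub_add_cancel (Fintype.card_pos_iff.2 ⟨A.augInit⟩)).symm⟩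
  rw [hd] at hlen
  obtain ⟨I, hI⟩ := hinc.isWellSeparated_one (d := d) hmem
    (CactusLetter.wordDepth_le fun a ha => by
      have h1 := (hmem a (by simp [ha])).2
      omega) hlen.le
  exact hI.exists_isSSRI hlen
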